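/- Let $S^2\subset\mathbb{R}^3$ be the unit sphere with its surface measure $\mathcal{H}^2$, with colatitude $\theta\in[0,\pi]$ and longitude $\varphi\in[0,2\pi)$, and let $$L^2_0(S^2)=\Big\{u\in L^2(S^2;\mathbb{C}) : \int_{S^2}u\,d\mathcal{H}^2=0\Big\}.$$ Let $\Delta$ be the Laplace--Beltrami operator of $S^2$, which is invertible as an operator in $L^2_0(S^2)$ with domain $L^2_0(S^2)\cap H^2(S^2)$, and put $B=I+6\Delta^{-1}$ on $L^2_0(S^2)$. Let $\Lambda$ be the operator in $L^2_0(S^2)$ given by $$\Lambda u=-i\,\partial_\varphi\big(\cos\theta\;Bu\big),\qquad D(\Lambda)=\{u\in L^2_0(S^2) : \partial_\varphi(\cos\theta\,u)\in L^2_0(S^2)\},$$ where $\partial_\varphi$ is taken in the weak sense. For $m\in\mathbb{Z}$ let $$(\mathcal{P}_mu)(\theta,\varphi)=\frac{e^{im\varphi}}{2\pi}\int_0^{2\pi}u(\theta,\phi)e^{-im\phi}\,d\phi ,$$ and for $m\neq0$ let $\Lambda_m$ be the operator $u\mapsto\cos\theta\;Bu$ on $\mathcal{P}_mL^2_0(S^2)$.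 Then: 1. $\Lambda$ has no eigenvalues in $\mathbb{C}\setminus\{0\}$, neither nonreal nor nonzero real ones: if $\mu\in\mathbb{C}\setminus\{0\}$, $u\in D(\Lambda)$ and $\Lambda u=\mu u$, then $u=0$. 2. For every $m\in\mathbb{Z}\setminus\{0\}$, $\Lambda_m$ has no eigenvalues in $\mathbb{C}\setminus\{0\}$: if $\mu\in\mathbb{C}\setminus\{0\}$, $u\in\mathcal{P}_mL^2_0(S^2)$ and $\Lambda_mu=\mu u$, then $u=0$. -/

import Mathlib

open MeasureTheory Real
open scoped Manifold ContDiff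

noncomputable section

namespace SphereFlow

/-- Euclidean three-space. -/
abbrev E3 : Type := EuclideanSpace ℝ (Fin 3)

/-- The unit sphere `S²` of `ℝ³`, with the smooth structure Mathlib gives it. -/
abbrev S2 : Type := Metric.sphere (0 : E3) 1

/-- The surface measure of `S²` (total mass `4π`). -/
def sigma : Measure S2 := (volume : Measure E3).toSphere

instance : IsFiniteMeasure sigma := by
  unfold sigma
  infer_instance

/-- The complex Hilbert space `L²(S²)`. -/
abbrev L2 : Type := Lp ℂ 2 sigma

lemma integrable_L2 (u : L2) : Integrable (fun x => u x) sigma :=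
  (Lp.memLp u).integrable (by norm_num)

/-- `L²₀(S²)`, the square-integrable functions of zero mean. -/
def L20 : Submodule ℂ L2 where
  carrier := {u | ∫ x, u x ∂sigma = 0}
  zero_mem' := by
    have h : ∫ x, (0 : L2) x ∂sigma = ∫ _x : S2, (0 : ℂ) ∂sigma :=
      integral_congr_ae (Lp.coeFn_zero ℂ 2 sigma)
    simpa using h
  add_mem' := by
    intro u v hu hv
    have h : ∫ x, (u + v) x ∂sigma = ∫ x, (u x + v x) ∂sigma :=
      integral_congr_ae (Lp.coeFn_add u v)
    have h' : ∫ x, (u x + v x) ∂sigma = 0 := by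
      rw [integral_add (integrable_L2 u) (integrable_L2 v)]
      simp only [Set.mem_ofPred_eq] at hu hv
      rw [hu, hv, add_zero]
    exact h.trans h'
  smul_mem' := by
    intro c u hu
    have h : ∫ x, (c • u) x ∂sigma = ∫ x, c • u x ∂sigma :=
      integral_congr_ae (Lp.coeFn_smul c u)
    have h' : ∫ x, c • u x ∂sigma = 0 := by
      rw [integral_smul]
      simp only [Set.mem_ofPred_eq] at hu
      rw [hu, smul_zero]
    exact h.trans h'

/-- The function `cos θ` (`θ` the colatitude), that is, the coordinate `x₃`. -/
def cosTheta (x : S2) : ℝ := (x : E3) 2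

/-- The rotation by the angle `s` about the `x₃`-axis; it sends the point with colatitude `θ` and
longitude `φ` to the point with colatitude `θ` and longitude `φ + s`. -/
def rot (s : ℝ) (x : S2) : S2 :=
  ⟨!₂[cos s * (x : E3) 0 - sin s * (x : E3) 1, sin s * (x : E3) 0 + cos s * (x : E3) 1,
      (x : E3) 2], by
    have hx : ‖(x : E3)‖ = 1 := by simp
    have h1 : (x : E3) 0 ^ 2 + (x : E3) 1 ^ 2 + (x : E3) 2 ^ 2 = 1 := by
      have h := EuclideanSpace.norm_sq_eq (x : E3)
      rw [hx, Fin.sum_univ_three] at h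
      simpa using h.symm
    have h2 := Real.sin_sq_add_cos_sq s
    rw [mem_sphere_zero_iff_norm, EuclideanSpace.norm_eq, Fin.sum_univ_three,
      Real.sqrt_eq_one]
    simp only [Real.norm_eq_abs, sq_abs, Matrix.cons_val]
    linear_combination h1 + ((x : E3) 0 ^ 2 + (x : E3) 1 ^ 2) * h2⟩

/-- Smooth complex-valued functions on `S²`. -/
def IsSmooth (ψ : S2 → ℂ) : Prop := ContMDiff (𝓡 2) 𝓘(ℝ, ℂ) ∞ ψ

/-- The extension of a function on `S²` to `ℝ³ ∖ {0}` that is constant along rays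
(with value `0` at the origin). -/
def radialExtension (ψ : S2 → ℂ) (y : E3) : ℂ :=
  open Classical in
  if h : y = 0 then 0
  else ψ ⟨‖y‖⁻¹ • y, by
    rw [mem_sphere_zero_iff_norm, norm_smul, norm_inv, norm_norm,
      inv_mul_cancel₀ (norm_ne_zero_iff.mpr h)]⟩

/-- The Laplace–Beltrami operator of `S²` on smooth functions. By
`Δ_{ℝ³} = ∂_r² + (2/r) ∂_r + r⁻² Δ_{S²}` it is the restriction to `S²` of the Euclidean Laplacian
of the extension that is constant along rays. -/
def laplaceBeltrami (ψ : S2 → ℂ) (x : S2) : ℂ :=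
  Laplacian.laplacian (radialExtension ψ) (x : E3)

/-- The longitudinal derivative `∂_φ` of smooth functions. -/
def dPhi (ψ : S2 → ℂ) (x : S2) : ℂ := deriv (fun s : ℝ => ψ (rot s x)) 0

/-- `Δ v = f` in the weak sense, against all smooth functions on the closed surface `S²`. -/
def HasWeakLaplacian (v f : S2 → ℂ) : Prop :=
  ∀ ψ : S2 → ℂ, IsSmooth ψ →
    ∫ x, v x * laplaceBeltrami ψ x ∂sigma = ∫ x, f x * ψ x ∂sigma

/-- `∂_φ w = g` in the weak sense, against all smooth functions on `S²`. -/
def HasWeakDPhi (w g : S2 → ℂ) : Prop :=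
  ∀ ψ : S2 → ℂ, IsSmooth ψ →
    ∫ x, w x * dPhi ψ x ∂sigma = -∫ x, g x * ψ x ∂sigma

/-- `v = Δ⁻¹ u` in `L²₀(S²)`: both functions have zero mean and `Δ v = u`. -/
def IsInvLaplacian (u v : L2) : Prop :=
  u ∈ L20 ∧ v ∈ L20 ∧ HasWeakLaplacian v u

/-- The graph of the operator `Λ = -i ∂_φ M_{cos θ} (I + 6 Δ⁻¹)` in `L²₀(S²)`: the pairs `(u, f)`
in `L²₀(S²) × L²₀(S²)` with `∂_φ (cos θ (u + 6 Δ⁻¹ u)) = i f`. The domain is the maximal one.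
As `∂_φ (cos θ Δ⁻¹ u)` is square-integrable for every `u` in `L²₀(S²)`, it consists of the `u` in
`L²₀(S²)` for which `∂_φ (cos θ u)` is square-integrable. -/
def Lambda : Set (L2 × L2) :=
  {p | p.1 ∈ L20 ∧ p.2 ∈ L20 ∧ ∃ v : L2, IsInvLaplacian p.1 v ∧
    HasWeakDPhi (fun x => (cosTheta x : ℂ) * (p.1 x + 6 * v x)) (fun x => Complex.I * p.2 x)}

/-- `(P_m u)(θ, φ) = (2π)⁻¹ e^{imφ} ∫₀^{2π} u(θ, φ') e^{-imφ'} dφ'`, written with `φ' = φ + s`. -/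
def modeProjection (m : ℤ) (u : S2 → ℂ) (x : S2) : ℂ :=
  (1 / (2 * π) : ℂ) *
    ∫ s in (0 : ℝ)..(2 * π), u (rot s x) * Complex.exp (-(Complex.I * (m : ℂ) * (s : ℂ)))

/-- `P_m L²₀(S²)`, the image of `L²₀(S²)` under `P_m`. -/
def modeSpace (m : ℤ) : Set L2 :=
  {u | ∃ f ∈ L20, ∀ᵐ x ∂sigma, u x = modeProjection m (fun y => f y) x}

/-- The graph of the operator `Λ_m = M_{cos θ} (I + 6 Δ⁻¹)` in `P_m L²₀(S²)`. -/
def LambdaMode (m : ℤ) : Set (L2 × L2) :=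
  {p | p.1 ∈ modeSpace m ∧ p.2 ∈ modeSpace m ∧ ∃ v : L2, IsInvLaplacian p.1 v ∧
    ∀ᵐ x ∂sigma, p.2 x = (cosTheta x : ℂ) * (p.1 x + 6 * v x)}

/-- `μ` is an eigenvalue of the operator with graph `T`: `T u = μ u` for some nonzero `u` in its
domain. -/
def IsEigenvalue (T : Set (L2 × L2)) (μ : ℂ) : Prop :=
  ∃ u : L2, u ≠ 0 ∧ (u, μ • u) ∈ T

end SphereFlow

end

open Set Filter Topology

noncomputable section

namespace SphereFlow

/-! Fourier expansion in the longitude turns both assertions into a statement on one ordinary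
differential equation. Put z = cos θ, w = 1 - z², |k| = n + 1, and let U and V = w^((n+1)/2) F be
the k-th coefficients of u and v = Δ⁻¹u. The eigenvalue equation reads z(U + 6V) = μU, where for
`Lambda` the number μ is the eigenvalue divided by k. Hence U = -6zV/(z - μ), and with the flux H =
w^(n+2) F' the equation Δv = u becomes H' = w^(n+1) ((n+1)(n+2) - 6z/(z - μ)) F. The core is
`ModeODE.eq_zero`: for μ ≠ 0, decay at the poles, together with F(μ) = 0 if μ lies in (-1, 1),
forces F = 0.

Nonreal μ. The combination Re(H F̄) - (Re μ / Im μ) Im(H F̄) vanishes at both poles, and its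
derivative is |H|²/w^(n+2) + w^(n+1) |F|² ((n+1)(n+2) - 6 + 6|μ|²/|z - μ|²). This is a sum of
nonnegative terms for n ≥ 1. For n = 0 the bracket contains 2 - 6 < 0, but the equation makes w F
the derivative of an explicit K vanishing at the poles. Thus V is orthogonal to the harmonic of
degree one, the next degree has eigenvalue 6, and completing squares with K restores positivity.

Real μ, say μ > 0 after a reflection. Integrability of U forces F(μ) = 0 when μ < 1. To the left of
μ the function (μ - z) w^(-n/2) is a positive strict supersolution, strict because μ > 0, and
Jacobi's identity gives F = 0 there. Then F and H both vanish at μ, and a Grönwall estimate with the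
weight 1/(z - μ) carries the vanishing across the singular point.

The remaining work passes from L² functions on the sphere to this equation. Archimedes' theorem
makes the surface measure Lebesgue measure in (z, φ); the test functions (x₁ ∓ i x₂)^|k| p(x₃)
isolate one mode; the lemma of du Bois-Reymond makes the weak equation classical; and Cauchy's
inequality for the flux through polar caps gives the decay at the poles. -/

/-- A function on an interval with nonnegative derivative and limit `0` at both ends is constant,
so that its derivative vanishes. -/
lemma deriv_eq_zero_of_nonneg_of_tendsto {a b : ℝ} {J J' : ℝ → ℝ}
    (hJ : ∀ z ∈ Ioo a b, HasDerivAt J (J' z) z) (hJ' : ∀ z ∈ Ioo a b, 0 ≤ J' z)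
    (ha : Tendsto J (𝓝[>] a) (𝓝 0)) (hb : Tendsto J (𝓝[<] b) (𝓝 0)) :
    ∀ z ∈ Ioo a b, J' z = 0 := by
  have hmono : MonotoneOn J (Ioo a b) := by
    refine monotoneOn_of_deriv_nonneg (convex_Ioo a b)
      (fun z hz => (hJ z hz).continuousAt.continuousWithinAt) ?_ ?_
    · rw [interior_Ioo]
      exact fun z hz => (hJ z hz).differentiableAt.differentiableWithinAt
    · rw [interior_Ioo]
      intro z hz
      rw [(hJ z hz).deriv]
      exact hJ' z hz
  have hzero : ∀ z ∈ Ioo a b, J z = 0 := by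
    intro z hz
    apply le_antisymm
    · refine ge_of_tendsto hb ?_
      filter_upwards [Ioo_mem_nhdsLT hz.2] with t ht
      exact hmono hz ⟨hz.1.trans ht.1, ht.2⟩ ht.1.le
    · refine le_of_tendsto ha ?_
      filter_upwards [Ioo_mem_nhdsGT hz.1] with t ht
      exact hmono ⟨ht.1, ht.2.trans hz.2⟩ hz ht.2.le
  intro z hz
  refine (hJ z hz).unique ((hasDerivAt_const z (0 : ℝ)).congr_of_eventuallyEq ?_)
  filter_upwards [Ioo_mem_nhds hz.1 hz.2] with t ht using hzero t ht

/-! ### Real spectral parameter: comparison and unique continuation -/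

/-- Real solutions of the eigenvalue equation in the longitudinal mode `n + 1`, for the profile
`(1 - z²)^((n+1)/2) f(z)` with flux `h = (1 - z²)^(n+2) f'`, away from the poles. -/
structure RealModeODE (n : ℕ) (μ : ℝ) (f h : ℝ → ℝ) : Prop where
  deriv_f : ∀ z ∈ Ioo (-1 : ℝ) 1, HasDerivAt f (h z / (1 - z ^ 2) ^ (n + 2)) z
  deriv_h : ∀ z ∈ Ioo (-1 : ℝ) 1, z ≠ μ →
    HasDerivAt h ((1 - z ^ 2) ^ (n + 1) * ((n + 1) * (n + 2) - 6 * z / (z - μ)) * f z) z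
  cont_h : ContinuousOn h (Ioo (-1) 1)
  mul_left : Tendsto (fun z => h z * f z) (𝓝[>] (-1)) (𝓝 0)
  mul_right : Tendsto (fun z => h z * f z) (𝓝[<] 1) (𝓝 0)
  sq_left : Tendsto (fun z => (1 - z ^ 2) ^ (n + 1) * f z ^ 2) (𝓝[>] (-1)) (𝓝 0)
  sq_right : Tendsto (fun z => (1 - z ^ 2) ^ (n + 1) * f z ^ 2) (𝓝[<] 1) (𝓝 0)
  vanish : μ ∈ Ioo (-1 : ℝ) 1 → f μ = 0

lemma one_sub_sq_pos {z : ℝ} (hz : z ∈ Ioo (-1 : ℝ) 1) : 0 < 1 - z ^ 2 := by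
  nlinarith [hz.1, hz.2]

lemma hasDerivAt_one_sub_sq (z : ℝ) : HasDerivAt (fun z : ℝ => 1 - z ^ 2) (-(2 * z)) z := by
  simpa using ((hasDerivAt_id z).pow 2).const_sub 1

lemma hasDerivAt_one_sub_sq_pow (k : ℕ) (z : ℝ) :
    HasDerivAt (fun z : ℝ => (1 - z ^ 2) ^ (k + 1))
      (-(2 * (k + 1) * z) * (1 - z ^ 2) ^ k) z := by
  refine ((hasDerivAt_one_sub_sq z).pow (k + 1)).congr_deriv ?_
  push_cast
  ring

/-- The logarithmic derivative, times `(1 - z²)^(n+2)`, of the supersolution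
`(μ - z) (1 - z²)^(-n/2)`. -/
def barrierFlux (n : ℕ) (μ z : ℝ) : ℝ :=
  -((1 - z ^ 2) ^ (n + 2) / (μ - z)) + n * z * (1 - z ^ 2) ^ (n + 1)

lemma hasDerivAt_barrierFlux (n : ℕ) (μ z : ℝ) (hz : μ - z ≠ 0) :
    HasDerivAt (barrierFlux n μ)
      (2 * (n + 2) * z * (1 - z ^ 2) ^ (n + 1) / (μ - z) - (1 - z ^ 2) ^ (n + 2) / (μ - z) ^ 2
        + n * (1 - z ^ 2) ^ (n + 1) - 2 * n * (n + 1) * z ^ 2 * (1 - z ^ 2) ^ n) z := by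
  have h1 := ((hasDerivAt_one_sub_sq_pow (n + 1) z).div ((hasDerivAt_id z).const_sub μ) hz).neg
  have h2 := (((hasDerivAt_id z).const_mul (n : ℝ)).mul (hasDerivAt_one_sub_sq_pow n z))
  refine (h1.add h2).congr_deriv ?_
  simp only [id]
  push_cast
  field_simp
  ring

namespace RealModeODE

variable {n : ℕ} {μ : ℝ} {f h : ℝ → ℝ}

/-- Jacobi's identity. If b = w^(n+2) φ'/φ and q is the zero-order coefficient of the equation, then
(h f - b f²)' is a square over w^(n+2) plus f² times the defect (q φ - (w^(n+2) φ')')/φ. For φ = (μ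
- z) w^(-n/2) the defect is the last bracket, which is positive when 0 < μ and z < μ. -/
lemma hasDerivAt_energy (S : RealModeODE n μ f h) {z : ℝ} (hz : z ∈ Ioo (-1 : ℝ) 1) (hzμ : z < μ) :
    HasDerivAt (fun z => h z * f z - barrierFlux n μ z * f z ^ 2)
      ((h z - barrierFlux n μ z * f z) ^ 2 / (1 - z ^ 2) ^ (n + 2)
        + (2 * μ / (μ - z) * (1 - z ^ 2) ^ (n + 1) + n * (n + 2) * (1 - z ^ 2) ^ n) * f z ^ 2) z := by
  have hw := (one_sub_sq_pos hz).ne'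
  have hd : μ - z ≠ 0 := (sub_pos.2 hzμ).ne'
  have hd' : z - μ ≠ 0 := (sub_neg.2 hzμ).ne
  have h1 := (S.deriv_h z hz hzμ.ne).mul (S.deriv_f z hz)
  have h2 := (hasDerivAt_barrierFlux n μ z hd).mul ((S.deriv_f z hz).pow 2)
  refine (h1.sub h2).congr_deriv ?_
  have e : z - μ = -(μ - z) := by ring
  simp only [barrierFlux, e, Pi.pow_apply, Nat.add_one_sub_one, pow_one, Nat.cast_ofNat]
  -- After the generalisation this reads z² = 1 - w, the only relation between z and w that the
  -- polynomial identity needs.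
  have hz2 : z ^ 2 = 1 - (1 - z ^ 2) := by ring
  generalize 1 - z ^ 2 = w at *
  generalize hd0 : μ - z = d at *
  obtain rfl : μ = d + z := by linarith
  field_simp
  ring_nf
  simp only [hz2]
  ring

lemma tendsto_energy {l : Filter ℝ} {c : ℝ → ℝ} {L : ℝ}
    (hc : (fun z => -((1 - z ^ 2) / (μ - z)) + n * z) =ᶠ[l] c) (hL : Tendsto c l (𝓝 L))
    (h1 : Tendsto (fun z => h z * f z) l (𝓝 0))
    (h2 : Tendsto (fun z => (1 - z ^ 2) ^ (n + 1) * f z ^ 2) l (𝓝 0)) :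
    Tendsto (fun z => h z * f z - barrierFlux n μ z * f z ^ 2) l (𝓝 0) := by
  have := h1.sub ((hL.congr' hc.symm).mul h2)
  rw [mul_zero, sub_zero] at this
  refine this.congr fun z => ?_
  simp only [barrierFlux]
  ring

/-- The barrier has a pole at μ. For μ < 1 it is compensated by the zero of f there; for μ = 1 by
the factor 1 - z of 1 - z²; for μ > 1 the pole lies outside the interval. -/
lemma tendsto_energy_right (S : RealModeODE n μ f h) (hμ : 0 < μ) :
    Tendsto (fun z => h z * f z - barrierFlux n μ z * f z ^ 2) (𝓝[<] (min μ 1)) (𝓝 0) := by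
  rcases lt_trichotomy μ 1 with h1 | h1 | h1
  · have hm : μ ∈ Ioo (-1 : ℝ) 1 := ⟨by linarith, h1⟩
    have hf0 := S.vanish hm
    rw [min_eq_left h1.le]
    have hfc : Tendsto f (𝓝[<] μ) (𝓝 0) := by
      have := (S.deriv_f μ hm).continuousAt.tendsto
      rw [hf0] at this
      exact this.mono_left nhdsWithin_le_nhds
    have hhc : Tendsto h (𝓝[<] μ) (𝓝 (h μ)) :=
      (S.cont_h.continuousAt (Ioo_mem_nhds hm.1 hm.2)).tendsto.mono_left nhdsWithin_le_nhds
    have hs := (hasDerivAt_iff_tendsto_slope.1 (S.deriv_f μ hm)).mono_left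
      (nhdsWithin_mono μ fun z (hz : z < μ) => hz.ne)
    have hp : Tendsto (fun z : ℝ => (1 - z ^ 2) ^ (n + 2)) (𝓝[<] μ) (𝓝 ((1 - μ ^ 2) ^ (n + 2))) :=
      (Continuous.tendsto (by fun_prop) μ).mono_left nhdsWithin_le_nhds
    have hq : Tendsto (fun z : ℝ => n * z * (1 - z ^ 2) ^ (n + 1)) (𝓝[<] μ)
        (𝓝 (n * μ * (1 - μ ^ 2) ^ (n + 1))) :=
      (Continuous.tendsto (by fun_prop) μ).mono_left nhdsWithin_le_nhds
    -- As f(μ) = 0, the singular term f²/(μ - z) is minus the slope of f at μ times f.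
    have := ((hhc.mul hfc).sub ((hp.mul hs).mul hfc)).sub (hq.mul (hfc.mul hfc))
    simp only [mul_zero, sub_zero] at this
    refine this.congr' ?_
    filter_upwards [self_mem_nhdsWithin] with z (hz : z < μ)
    have hd : μ - z ≠ 0 := (sub_pos.2 hz).ne'
    have hd' : z - μ ≠ 0 := (sub_neg.2 hz).ne
    rw [slope_def_field, hf0, barrierFlux]
    have e : z - μ = -(μ - z) := by ring
    rw [e]
    field_simp
    ring
  · rw [h1, min_self]
    subst h1
    refine tendsto_energy (c := fun z => -(1 + z) + n * z) (L := -(1 + 1) + n * 1) ?_ ?_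
      S.mul_right S.sq_right
    · filter_upwards [self_mem_nhdsWithin] with z (hz : z < 1)
      have : 1 - z ≠ 0 := (sub_pos.2 hz).ne'
      field_simp
      ring
    · exact (Continuous.tendsto (by fun_prop) (1 : ℝ)).mono_left nhdsWithin_le_nhds
  · rw [min_eq_right h1.le]
    refine tendsto_energy EventuallyEq.rfl (ContinuousAt.tendsto (x := (1 : ℝ)) ?_ |>.mono_left
      nhdsWithin_le_nhds) S.mul_right S.sq_right
    have : μ - 1 ≠ 0 := (sub_pos.2 h1).ne'
    fun_prop (disch := assumption)

lemma eq_zero_of_lt (S : RealModeODE n μ f h) (hμ : 0 < μ) :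
    ∀ z ∈ Ioo (-1 : ℝ) (min μ 1), f z = 0 := by
  have hsub : ∀ z ∈ Ioo (-1 : ℝ) (min μ 1), z ∈ Ioo (-1 : ℝ) 1 ∧ z < μ := fun z hz =>
    ⟨⟨hz.1, hz.2.trans_le (min_le_right _ _)⟩, hz.2.trans_le (min_le_left _ _)⟩
  have hl : Tendsto (fun z => h z * f z - barrierFlux n μ z * f z ^ 2) (𝓝[>] (-1)) (𝓝 0) := by
    refine tendsto_energy EventuallyEq.rfl (ContinuousAt.tendsto (x := (-1 : ℝ)) ?_ |>.mono_left
      nhdsWithin_le_nhds) S.mul_left S.sq_left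
    have : μ - -1 ≠ 0 := by linarith
    fun_prop (disch := assumption)
  intro z hz
  have hd : 0 < μ - z := sub_pos.2 (hsub z hz).2
  have hw := one_sub_sq_pos (hsub z hz).1
  have key := deriv_eq_zero_of_nonneg_of_tendsto
    (fun z hz => S.hasDerivAt_energy (hsub z hz).1 (hsub z hz).2) (fun z hz => ?_) hl
    (S.tendsto_energy_right hμ) z hz
  · have h1 : 0 ≤ (h z - barrierFlux n μ z * f z) ^ 2 / (1 - z ^ 2) ^ (n + 2) := by positivity
    have h2 : 0 < 2 * μ / (μ - z) * (1 - z ^ 2) ^ (n + 1) + n * (n + 2) * (1 - z ^ 2) ^ n := by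
      positivity
    by_contra hf
    have : 0 < f z ^ 2 := by positivity
    nlinarith [mul_pos h2 this]
  · have hd : 0 < μ - z := sub_pos.2 (hsub z hz).2
    have hw := one_sub_sq_pos (hsub z hz).1
    positivity

lemma flux_coeff_sq_le (n : ℕ) {μ z : ℝ} (hμ : 0 < μ) (hz : μ < z) (hz1 : z < 1) :
    ((1 - z ^ 2) ^ (n + 1) * ((n + 1) * (n + 2) * (z - μ) - 6 * z)) ^ 2
      ≤ ((n + 1 : ℝ) * (n + 2) + 6) ^ 2 := by
  have hz0 : 0 < z := hμ.trans hz
  have hw : 0 ≤ 1 - z ^ 2 := by nlinarith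
  have hp0 : 0 ≤ (1 - z ^ 2) ^ (n + 1) := pow_nonneg hw _
  have hp1 : (1 - z ^ 2) ^ (n + 1) ≤ 1 := pow_le_one₀ hw (by nlinarith)
  set l : ℝ := (n + 1) * (n + 2) with hl
  have hl0 : 0 ≤ l := by positivity
  have a1 : 0 ≤ l * (z - μ) := mul_nonneg hl0 (sub_pos.2 hz).le
  have a2 : l * (z - μ) ≤ l := mul_le_of_le_one_right hl0 (by linarith)
  have a3 : |l * (z - μ) - 6 * z| ≤ l + 6 := abs_le.2 ⟨by linarith, by linarith⟩
  rw [sq_le_sq, abs_mul, abs_of_nonneg hp0, abs_of_nonneg (by linarith : 0 ≤ l + 6)]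
  exact (mul_le_of_le_one_left (abs_nonneg _) hp1).trans a3

/-- Each cross term costs half of φ², so that -φ² absorbs both. -/
lemma cross_terms_le {a q k φ A B : ℝ} (hq : q ^ 2 ≤ A) (hk : k ^ 2 ≤ B) :
    2 * a * q * φ + 2 * φ * a * k - φ ^ 2 ≤ (2 * A + 2 * B) * a ^ 2 := by
  have h1 := mul_le_mul_of_nonneg_right hq (sq_nonneg a)
  have h2 := mul_le_mul_of_nonneg_right hk (sq_nonneg a)
  have h3 := sq_nonneg (2 * q * a - φ)
  have h4 := sq_nonneg (2 * k * a - φ)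
  linarith

/-- Unique continuation through the singular point, starting from the zero solution on its left. The
weight in h² + f²/(z - μ) contributes -φ² with φ = f/(z - μ) to the derivative. That term controls
the singular coefficient, and the rest is bounded by a multiple of h². -/
lemma eq_zero_of_gt (S : RealModeODE n μ f h) (hμ : 0 < μ) {z₀ : ℝ} (hz₀ : z₀ ∈ Ioo μ 1) :
    f z₀ = 0 := by
  have hm : μ ∈ Ioo (-1 : ℝ) 1 := ⟨by linarith, hz₀.1.trans hz₀.2⟩
  have hf0 := S.vanish hm
  have hleft : ∀ z ∈ Ioo (-1 : ℝ) μ, f z = 0 := by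
    have := S.eq_zero_of_lt hμ
    rwa [min_eq_left hm.2.le] at this
  have hcont := S.cont_h.continuousAt (Ioo_mem_nhds hm.1 hm.2)
  -- The flux vanishes where f is locally zero, and it is continuous across μ.
  have hh0 : h μ = 0 := by
    refine tendsto_nhds_unique (hcont.tendsto.mono_left nhdsWithin_le_nhds :
      Tendsto h (𝓝[<] μ) _) (tendsto_const_nhds.congr' ?_)
    filter_upwards [Ioo_mem_nhdsLT hm.1] with z hz
    have hz1 : z ∈ Ioo (-1 : ℝ) 1 := ⟨hz.1, hz.2.trans hm.2⟩
    have := (S.deriv_f z hz1).unique ((hasDerivAt_const z (0 : ℝ)).congr_of_eventuallyEq (by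
      filter_upwards [Ioo_mem_nhds hz.1 hz.2] with t ht using hleft t ht))
    rw [div_eq_zero_iff] at this
    exact (this.resolve_right (pow_ne_zero _ (one_sub_sq_pos hz1).ne')).symm
  set b := (z₀ + 1) / 2 with hb
  have hzb : z₀ < b := by rw [hb]; linarith [hz₀.2]
  have hb1 : b < 1 := by rw [hb]; linarith [hz₀.2]
  have hIoo : ∀ z ∈ Ioo μ b, z ∈ Ioo (-1 : ℝ) 1 := fun z hz => ⟨hm.1.trans hz.1, hz.2.trans hb1⟩
  set W := (1 - b ^ 2) ^ (n + 2) with hW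
  have hb0 : 0 < b := by linarith [hz₀.1]
  have hWpos : 0 < W := pow_pos (by nlinarith) _
  set Q := (n + 1 : ℝ) * (n + 2) + 6 with hQ
  -- The constant of `cross_terms_le`: Q bounds (z - μ) times the coefficient in h', and 1/W bounds
  -- the one in f'.
  set C := 2 * Q ^ 2 + 2 * (1 / W ^ 2) with hC
  have hCpos : 0 ≤ C := by positivity
  have hderiv : ∀ z ∈ Ioo μ b, HasDerivAt (fun z => exp (-C * z) * (h z ^ 2 + f z ^ 2 / (z - μ)))
      (exp (-C * z) * (2 * h z * ((1 - z ^ 2) ^ (n + 1) *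
        ((n + 1) * (n + 2) - 6 * z / (z - μ)) * f z) +
        (2 * f z * (h z / (1 - z ^ 2) ^ (n + 2)) / (z - μ) - f z ^ 2 / (z - μ) ^ 2)
        - C * (h z ^ 2 + f z ^ 2 / (z - μ)))) z := by
    intro z hz
    have hd : z - μ ≠ 0 := (sub_pos.2 hz.1).ne'
    have h1 := (S.deriv_h z (hIoo z hz) hz.1.ne').pow 2
    have h2 := ((S.deriv_f z (hIoo z hz)).pow 2).div ((hasDerivAt_id z).sub_const μ) hd
    have h3 := ((hasDerivAt_id z).const_mul (-C)).exp
    refine (h3.mul (h1.add h2)).congr_deriv ?_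
    simp only [id, Pi.pow_apply, Pi.add_apply, Pi.div_apply]
    have hw := (one_sub_sq_pos (hIoo z hz)).ne'
    push_cast
    field_simp
    ring
  have hanti : AntitoneOn (fun z => exp (-C * z) * (h z ^ 2 + f z ^ 2 / (z - μ))) (Ioo μ b) := by
    refine antitoneOn_of_deriv_nonpos (convex_Ioo μ b)
      (fun z hz => (hderiv z hz).continuousAt.continuousWithinAt) ?_ ?_
    · rw [interior_Ioo]
      exact fun z hz => (hderiv z hz).differentiableAt.differentiableWithinAt
    rw [interior_Ioo]
    intro z hz
    rw [(hderiv z hz).deriv]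
    refine mul_nonpos_of_nonneg_of_nonpos (exp_pos _).le ?_
    have hd : 0 < z - μ := sub_pos.2 hz.1
    have hw := one_sub_sq_pos (hIoo z hz)
    have hz0 : 0 < z := hμ.trans hz.1
    have hw1 : 1 - z ^ 2 ≤ 1 := by nlinarith
    set q := (1 - z ^ 2) ^ (n + 1) * ((n + 1) * (n + 2) * (z - μ) - 6 * z) with hq
    set φ := f z / (z - μ) with hφ
    set k := 1 / (1 - z ^ 2) ^ (n + 2) with hk
    have hqQ : q ^ 2 ≤ Q ^ 2 := flux_coeff_sq_le n hμ hz.1 (hz.2.trans hb1)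
    have hkW : k ^ 2 ≤ 1 / W ^ 2 := by
      rw [hk, div_pow, one_pow]
      have : W ≤ (1 - z ^ 2) ^ (n + 2) := by
        rw [hW]
        apply pow_le_pow_left₀ (by nlinarith)
        nlinarith [hz.2]
      gcongr
    have e1 : 2 * h z * ((1 - z ^ 2) ^ (n + 1) * ((n + 1) * (n + 2) - 6 * z / (z - μ)) * f z) +
        (2 * f z * (h z / (1 - z ^ 2) ^ (n + 2)) / (z - μ) - f z ^ 2 / (z - μ) ^ 2) =
        2 * h z * q * φ + 2 * φ * h z * k - φ ^ 2 := by
      rw [hq, hφ, hk]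
      field_simp
      ring
    have e2 : 0 ≤ f z ^ 2 / (z - μ) := by positivity
    rw [e1]
    have e3 := cross_terms_le (a := h z) (φ := φ) hqQ hkW
    have e6 : 0 ≤ C * (f z ^ 2 / (z - μ)) := by positivity
    linarith
  have hlim : Tendsto (fun z => exp (-C * z) * (h z ^ 2 + f z ^ 2 / (z - μ))) (𝓝[>] μ) (𝓝 0) := by
    have hs := (hasDerivAt_iff_tendsto_slope.1 (S.deriv_f μ hm)).mono_left
      (nhdsWithin_mono μ fun z (hz : μ < z) => hz.ne')
    have hfc : Tendsto f (𝓝[>] μ) (𝓝 0) := by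
      have := (S.deriv_f μ hm).continuousAt.tendsto
      rw [hf0] at this
      exact this.mono_left nhdsWithin_le_nhds
    have hhc : Tendsto h (𝓝[>] μ) (𝓝 0) := by
      have := hcont.tendsto
      rw [hh0] at this
      exact this.mono_left nhdsWithin_le_nhds
    have he : Tendsto (fun z => exp (-C * z)) (𝓝[>] μ) (𝓝 (exp (-C * μ))) :=
      (Continuous.tendsto (by fun_prop) μ).mono_left nhdsWithin_le_nhds
    -- Here f²/(z - μ) is f times its slope at μ, because f(μ) = 0.
    have := he.mul ((hhc.pow 2).add (hfc.mul hs))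
    simp only [zero_mul, add_zero, ne_eq, OfNat.ofNat_ne_zero, not_false_eq_true, zero_pow,
      mul_zero] at this
    refine this.congr fun z => ?_
    rw [slope_def_field, hf0]
    ring
  have hle : exp (-C * z₀) * (h z₀ ^ 2 + f z₀ ^ 2 / (z₀ - μ)) ≤ 0 := by
    refine ge_of_tendsto hlim ?_
    filter_upwards [Ioo_mem_nhdsGT hz₀.1] with t ht
    exact hanti ⟨ht.1, ht.2.trans hzb⟩ ⟨hz₀.1, hzb⟩ ht.2.le
  have hd : 0 < z₀ - μ := sub_pos.2 hz₀.1
  by_contra hf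
  have : 0 < exp (-C * z₀) * (h z₀ ^ 2 + f z₀ ^ 2 / (z₀ - μ)) := by positivity
  linarith

lemma eq_zero_of_pos (S : RealModeODE n μ f h) (hμ : 0 < μ) : ∀ z ∈ Ioo (-1 : ℝ) 1, f z = 0 := by
  intro z hz
  rcases lt_trichotomy z μ with h1 | h1 | h1
  · exact S.eq_zero_of_lt hμ z ⟨hz.1, lt_min h1 hz.2⟩
  · subst h1
    exact S.vanish hz
  · exact S.eq_zero_of_gt hμ ⟨h1, hz.2⟩

lemma tendsto_neg_nhdsGT (a : ℝ) : Tendsto (fun z : ℝ => -z) (𝓝[>] (-a)) (𝓝[<] a) := by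
  refine tendsto_nhdsWithin_iff.2 ⟨?_, ?_⟩
  · have := (continuous_neg.tendsto (-a : ℝ)).mono_left (nhdsWithin_le_nhds (s := Ioi (-a)))
    rwa [neg_neg] at this
  · filter_upwards [self_mem_nhdsWithin] with z (hz : -a < z)
    exact neg_lt.1 hz

lemma tendsto_neg_nhdsLT (a : ℝ) : Tendsto (fun z : ℝ => -z) (𝓝[<] a) (𝓝[>] (-a)) := by
  refine tendsto_nhdsWithin_iff.2 ⟨?_, ?_⟩
  · exact (continuous_neg.tendsto (a : ℝ)).mono_left nhdsWithin_le_nhds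
  · filter_upwards [self_mem_nhdsWithin] with z (hz : z < a)
    exact neg_lt_neg hz

/-- Reflection in the equator. -/
lemma reflect (S : RealModeODE n μ f h) :
    RealModeODE n (-μ) (fun z => f (-z)) (fun z => -h (-z)) := by
  have hm : ∀ {z : ℝ}, z ∈ Ioo (-1 : ℝ) 1 → -z ∈ Ioo (-1 : ℝ) 1 := fun hz =>
    ⟨neg_lt_neg hz.2, by linarith [hz.1]⟩
  constructor
  · intro z hz
    refine ((S.deriv_f (-z) (hm hz)).scomp z (hasDerivAt_neg z)).congr_deriv ?_
    simp only [neg_smul, one_smul, neg_sq]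
    ring
  · intro z hz hne
    have hne' : -z ≠ μ := fun e => hne (by rw [← e, neg_neg])
    refine ((S.deriv_h (-z) (hm hz) hne').scomp z (hasDerivAt_neg z)).neg.congr_deriv ?_
    simp only [neg_smul, one_smul, neg_sq, neg_neg]
    have e : -z - μ = -(z - -μ) := by ring
    rw [e, mul_neg, neg_div_neg_eq]
  · exact (S.cont_h.comp continuousOn_neg fun z hz => hm hz).neg
  · have := (S.mul_right.comp (tendsto_neg_nhdsGT 1)).neg
    rw [neg_zero] at this
    exact this.congr fun z => by simp
  · have := (S.mul_left.comp (tendsto_neg_nhdsLT 1)).neg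
    rw [neg_zero] at this
    exact this.congr fun z => by simp
  · exact (S.sq_right.comp (tendsto_neg_nhdsGT 1)).congr fun z => by simp
  · exact (S.sq_left.comp (tendsto_neg_nhdsLT 1)).congr fun z => by simp
  · intro h1
    simpa using S.vanish (by simpa using hm h1)

lemma eq_zero (S : RealModeODE n μ f h) (hμ : μ ≠ 0) : ∀ z ∈ Ioo (-1 : ℝ) 1, f z = 0 := by
  rcases lt_or_gt_of_ne hμ with h1 | h1
  · intro z hz
    simpa using S.reflect.eq_zero_of_pos (neg_pos.2 h1) (-z) ⟨neg_lt_neg hz.2, by linarith [hz.1]⟩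
  · exact S.eq_zero_of_pos h1

end RealModeODE

/-! ### Complex spectral parameter: energy identities -/

/-- Solutions of the eigenvalue equation in the longitudinal mode `n + 1`, for the profile
`(1 - z²)^((n+1)/2) F(z)` with flux `H = (1 - z²)^(n+2) F'`, away from the poles. -/
structure ModeODE (n : ℕ) (μ : ℂ) (F H : ℝ → ℂ) : Prop where
  deriv_F : ∀ z ∈ Ioo (-1 : ℝ) 1, HasDerivAt F (H z / (((1 - z ^ 2) ^ (n + 2) : ℝ) : ℂ)) z
  deriv_H : ∀ z ∈ Ioo (-1 : ℝ) 1, (z : ℂ) ≠ μ →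
    HasDerivAt H ((((1 - z ^ 2) ^ (n + 1) : ℝ) : ℂ) *
      ((((n + 1) * (n + 2) : ℝ) : ℂ) - 6 * z / (z - μ)) * F z) z
  cont_H : ContinuousOn H (Ioo (-1) 1)
  mul_left : Tendsto (fun z => ‖H z‖ * ‖F z‖) (𝓝[>] (-1)) (𝓝 0)
  mul_right : Tendsto (fun z => ‖H z‖ * ‖F z‖) (𝓝[<] 1) (𝓝 0)
  sq_left : Tendsto (fun z => (1 - z ^ 2) ^ (n + 1) * ‖F z‖ ^ 2) (𝓝[>] (-1)) (𝓝 0)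
  sq_right : Tendsto (fun z => (1 - z ^ 2) ^ (n + 1) * ‖F z‖ ^ 2) (𝓝[<] 1) (𝓝 0)
  flux_left : Tendsto (fun z => ‖H z‖ ^ 2 / (1 - z ^ 2) ^ (n + 2)) (𝓝[>] (-1)) (𝓝 0)
  flux_right : Tendsto (fun z => ‖H z‖ ^ 2 / (1 - z ^ 2) ^ (n + 2)) (𝓝[<] 1) (𝓝 0)
  vanish : ∀ x ∈ Ioo (-1 : ℝ) 1, (x : ℂ) = μ → F x = 0

lemma _root_.HasDerivAt.complex_re {F : ℝ → ℂ} {F' : ℂ} {z : ℝ} (h : HasDerivAt F F' z) :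
    HasDerivAt (fun z => (F z).re) F'.re z :=
  Complex.reCLM.hasFDerivAt.comp_hasDerivAt z h

lemma _root_.HasDerivAt.complex_im {F : ℝ → ℂ} {F' : ℂ} {z : ℝ} (h : HasDerivAt F F' z) :
    HasDerivAt (fun z => (F z).im) F'.im z :=
  Complex.imCLM.hasFDerivAt.comp_hasDerivAt z h

lemma tendsto_mul_of_norm {l : Filter ℝ} {A B : ℝ → ℂ} {p q : ℂ → ℝ}
    (hp : ∀ c, |p c| ≤ ‖c‖) (hq : ∀ c, |q c| ≤ ‖c‖)
    (h : Tendsto (fun z => ‖A z‖ * ‖B z‖) l (𝓝 0)) :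
    Tendsto (fun z => p (A z) * q (B z)) l (𝓝 0) := by
  refine squeeze_zero_norm (fun z => ?_) h
  rw [norm_mul]
  exact mul_le_mul (hp _) (hq _) (norm_nonneg _) (norm_nonneg _)

lemma eventually_mem_nhdsGT : ∀ᶠ z in 𝓝[>] (-1 : ℝ), z ∈ Ioo (-1 : ℝ) 1 :=
  Ioo_mem_nhdsGT (by norm_num)

lemma eventually_mem_nhdsLT : ∀ᶠ z in 𝓝[<] (1 : ℝ), z ∈ Ioo (-1 : ℝ) 1 :=
  Ioo_mem_nhdsLT (by norm_num)

lemma hasDerivAt_re_mul_conj {A B : ℝ → ℂ} {A' B' : ℂ} {z : ℝ} (hA : HasDerivAt A A' z)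
    (hB : HasDerivAt B B' z) :
    HasDerivAt (fun z => (A z).re * (B z).re + (A z).im * (B z).im)
      (A'.re * (B z).re + A'.im * (B z).im + ((A z).re * B'.re + (A z).im * B'.im)) z := by
  refine ((hA.complex_re.mul hB.complex_re).add (hA.complex_im.mul hB.complex_im)).congr_deriv ?_
  ring

lemma hasDerivAt_im_mul_conj {A B : ℝ → ℂ} {A' B' : ℂ} {z : ℝ} (hA : HasDerivAt A A' z)
    (hB : HasDerivAt B B' z) :
    HasDerivAt (fun z => (A z).im * (B z).re - (A z).re * (B z).im)
      (A'.im * (B z).re - A'.re * (B z).im + ((A z).im * B'.re - (A z).re * B'.im)) z := by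
  refine ((hA.complex_im.mul hB.complex_re).sub (hA.complex_re.mul hB.complex_im)).congr_deriv ?_
  ring

lemma tendsto_re_mul_conj {l : Filter ℝ} {A B : ℝ → ℂ}
    (h : Tendsto (fun z => ‖A z‖ * ‖B z‖) l (𝓝 0)) :
    Tendsto (fun z => (A z).re * (B z).re + (A z).im * (B z).im) l (𝓝 0) := by
  simpa using (tendsto_mul_of_norm Complex.abs_re_le_norm Complex.abs_re_le_norm h).add
    (tendsto_mul_of_norm Complex.abs_im_le_norm Complex.abs_im_le_norm h)

lemma tendsto_im_mul_conj {l : Filter ℝ} {A B : ℝ → ℂ}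
    (h : Tendsto (fun z => ‖A z‖ * ‖B z‖) l (𝓝 0)) :
    Tendsto (fun z => (A z).im * (B z).re - (A z).re * (B z).im) l (𝓝 0) := by
  simpa using (tendsto_mul_of_norm Complex.abs_im_le_norm Complex.abs_re_le_norm h).sub
    (tendsto_mul_of_norm Complex.abs_re_le_norm Complex.abs_im_le_norm h)

namespace ModeODE

variable {n : ℕ} {μ : ℂ} {F H : ℝ → ℂ}

lemma re_flux_coeff {μ : ℂ} {z : ℝ} (l w : ℝ) (F : ℂ) :
    ((w : ℂ) * ((l : ℂ) - 6 * z / (z - μ)) * F).re =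
      w * ((l - 6 * z * (z - μ.re) / ((z - μ.re) ^ 2 + μ.im ^ 2)) * F.re
        + 6 * z * μ.im / ((z - μ.re) ^ 2 + μ.im ^ 2) * F.im) := by
  have hD : Complex.normSq (z - μ) = (z - μ.re) ^ 2 + μ.im ^ 2 := by
    rw [Complex.normSq_apply]; simp; ring
  rw [← hD]
  simp [Complex.div_re, Complex.div_im]
  ring

lemma im_flux_coeff {μ : ℂ} {z : ℝ} (l w : ℝ) (F : ℂ) :
    ((w : ℂ) * ((l : ℂ) - 6 * z / (z - μ)) * F).im =
      w * ((l - 6 * z * (z - μ.re) / ((z - μ.re) ^ 2 + μ.im ^ 2)) * F.im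
        - 6 * z * μ.im / ((z - μ.re) ^ 2 + μ.im ^ 2) * F.re) := by
  have hD : Complex.normSq (z - μ) = (z - μ.re) ^ 2 + μ.im ^ 2 := by
    rw [Complex.normSq_apply]; simp; ring
  rw [← hD]
  simp [Complex.div_re, Complex.div_im]
  ring

/-- The energy density whose derivative is the integrand of the combined real and imaginary parts
of the Rayleigh identity. -/
def energy (μ : ℂ) (F H : ℝ → ℂ) (z : ℝ) : ℝ :=
  ((H z).re * (F z).re + (H z).im * (F z).im)
    - μ.re / μ.im * ((H z).im * (F z).re - (H z).re * (F z).im)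

/-- The factor Re μ / Im μ is chosen so that the real and imaginary parts of -6z/(z - μ) combine to
-6(z² - 2z Re μ)/|z - μ|², which equals -6 + 6|μ|²/|z - μ|². -/
lemma hasDerivAt_energy (S : ModeODE n μ F H) (hμ : μ.im ≠ 0) {z : ℝ} (hz : z ∈ Ioo (-1 : ℝ) 1) :
    HasDerivAt (energy μ F H)
      (‖H z‖ ^ 2 / (1 - z ^ 2) ^ (n + 2) + (1 - z ^ 2) ^ (n + 1) * ‖F z‖ ^ 2 *
        ((n + 1) * (n + 2) - 6 + 6 * ‖μ‖ ^ 2 / ((z - μ.re) ^ 2 + μ.im ^ 2))) z := by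
  have hne : (z : ℂ) ≠ μ := fun e => hμ (by rw [← e]; simp)
  have hA := S.deriv_H z hz hne
  have hB := S.deriv_F z hz
  refine ((hasDerivAt_re_mul_conj hA hB).sub
    ((hasDerivAt_im_mul_conj hA hB).const_mul (μ.re / μ.im))).congr_deriv ?_
  rw [re_flux_coeff, im_flux_coeff, Complex.div_ofReal_re,
    Complex.div_ofReal_im]
  simp only [Complex.sq_norm, Complex.normSq_apply]
  have hw := (one_sub_sq_pos hz).ne'
  have hD : (z - μ.re) ^ 2 + μ.im ^ 2 ≠ 0 := by positivity
  field_simp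
  ring

lemma tendsto_energy {l : Filter ℝ} (h : Tendsto (fun z => ‖H z‖ * ‖F z‖) l (𝓝 0)) :
    Tendsto (energy μ F H) l (𝓝 0) := by
  have := (tendsto_re_mul_conj h).sub ((tendsto_im_mul_conj h).const_mul (μ.re / μ.im))
  rw [mul_zero, sub_zero] at this
  exact this

/-- For n ≥ 1 one has (n+1)(n+2) ≥ 6, so the derivative of the energy is nonnegative and controls
|F|², while the energy vanishes at both poles. -/
lemma eq_zero_of_im_ne_zero_of_pos (S : ModeODE n μ F H) (hμ : μ.im ≠ 0) (hn : 0 < n) :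
    ∀ z ∈ Ioo (-1 : ℝ) 1, F z = 0 := by
  have hμ0 : μ ≠ 0 := fun e => hμ (by rw [e]; rfl)
  have hn1 : (1 : ℝ) ≤ n := by exact_mod_cast hn
  have hpos : ∀ z : ℝ,
      0 < (n + 1 : ℝ) * (n + 2) - 6 + 6 * ‖μ‖ ^ 2 / ((z - μ.re) ^ 2 + μ.im ^ 2) := by
    intro z
    have h1 : 0 < 6 * ‖μ‖ ^ 2 / ((z - μ.re) ^ 2 + μ.im ^ 2) := by positivity
    nlinarith
  intro z hz
  have key := deriv_eq_zero_of_nonneg_of_tendsto (fun z hz => S.hasDerivAt_energy hμ hz)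
    (fun z hz => by
      have h1 := hpos z
      have hw := one_sub_sq_pos hz
      positivity) (tendsto_energy S.mul_left) (tendsto_energy S.mul_right) z hz
  have h1 := hpos z
  have hw := one_sub_sq_pos hz
  by_contra hF
  have : 0 < ‖F z‖ := norm_pos_iff.2 hF
  have : 0 < ‖H z‖ ^ 2 / (1 - z ^ 2) ^ (n + 2) + (1 - z ^ 2) ^ (n + 1) * ‖F z‖ ^ 2 *
        ((n + 1) * (n + 2) - 6 + 6 * ‖μ‖ ^ 2 / ((z - μ.re) ^ 2 + μ.im ^ 2)) := by positivity
  exact this.ne' key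

/-- A primitive of `(1 - z²) F` in the first longitudinal mode. -/
def primitive (μ : ℂ) (F H : ℝ → ℂ) (z : ℝ) : ℂ :=
  (((1 - z ^ 2) ^ 2 : ℝ) * F z - (z - μ) * H z) / (2 * μ)

/-- In (w² F)' - ((z - μ) H)' the two copies of H and the terms 4zwF cancel, and 2μwF remains. As
the primitive tends to 0 at the poles, w F has mean zero: this is the orthogonality to the harmonic
of degree one. -/
lemma hasDerivAt_primitive (S : ModeODE 0 μ F H) (hμ : μ ≠ 0) {z : ℝ} (hz : z ∈ Ioo (-1 : ℝ) 1)
    (hne : (z : ℂ) ≠ μ) : HasDerivAt (primitive μ F H) (((1 - z ^ 2 : ℝ) : ℂ) * F z) z := by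
  have h1 := (hasDerivAt_one_sub_sq_pow 1 z).ofReal_comp
  have h2 := ((hasDerivAt_id z).ofReal_comp).sub_const μ
  refine (((h1.mul (S.deriv_F z hz)).sub (h2.mul (S.deriv_H z hz hne))).div_const
    (2 * μ)).congr_deriv ?_
  have hw : (1 - (z : ℂ) ^ 2) ≠ 0 := by
    have := (one_sub_sq_pos hz).ne'
    exact_mod_cast this
  have hd : (z : ℂ) - μ ≠ 0 := sub_ne_zero.2 hne
  push_cast [id]
  field_simp
  ring

/-- The terms in the primitive K of w F are null: they vanish at the poles. Their coefficients 8 and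
16z complete the squares for |H|²/w² - 4w|F|², and both squares are zero for the harmonic of degree
two, F = z, K = -w²/4, H = w². -/
def firstEnergy (μ : ℂ) (F H : ℝ → ℂ) (z : ℝ) : ℝ :=
  energy μ F H z + 8 * ((primitive μ F H z).re * (F z).re + (primitive μ F H z).im * (F z).im)
    + 16 * z * ((primitive μ F H z).re * (primitive μ F H z).re
      + (primitive μ F H z).im * (primitive μ F H z).im) / (1 - z ^ 2) ^ 2

lemma hasDerivAt_firstEnergy (S : ModeODE 0 μ F H) (hμ : μ.im ≠ 0) {z : ℝ}
    (hz : z ∈ Ioo (-1 : ℝ) 1) :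
    HasDerivAt (firstEnergy μ F H)
      (‖H z + 4 * primitive μ F H z‖ ^ 2 / (1 - z ^ 2) ^ 2
        + 4 * ‖((1 - z ^ 2 : ℝ) : ℂ) * F z + ((4 * z / (1 - z ^ 2) : ℝ) : ℂ) * primitive μ F H z‖ ^ 2
          / (1 - z ^ 2)
        + (1 - z ^ 2) * ‖F z‖ ^ 2 * (6 * ‖μ‖ ^ 2 / ((z - μ.re) ^ 2 + μ.im ^ 2))) z := by
  have hμ0 : μ ≠ 0 := fun e => hμ (by rw [e]; rfl)
  have hne : (z : ℂ) ≠ μ := fun e => hμ (by rw [← e]; simp)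
  have hK := S.hasDerivAt_primitive hμ0 hz hne
  have hw := (one_sub_sq_pos hz).ne'
  refine (((S.hasDerivAt_energy hμ hz).add ((hasDerivAt_re_mul_conj hK
    (S.deriv_F z hz)).const_mul 8)).add (((((hasDerivAt_id z).const_mul 16).mul
    (hasDerivAt_re_mul_conj hK hK)).div (hasDerivAt_one_sub_sq_pow 1 z)
      (pow_ne_zero _ hw)))).congr_deriv ?_
  rw [Complex.div_ofReal_re, Complex.div_ofReal_im]
  simp only [Complex.sq_norm, Complex.normSq_apply, Complex.ofReal_re, Complex.ofReal_im,
    Complex.add_re, Complex.add_im, Complex.mul_re, Complex.mul_im, Complex.re_ofNat,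
    Complex.im_ofNat, Pi.mul_apply, id, CharP.cast_eq_zero]
  generalize primitive μ F H z = K
  have hD : (z - μ.re) ^ 2 + μ.im ^ 2 ≠ 0 := by positivity
  have hz2 : z ^ 2 = 1 - (1 - z ^ 2) := by ring
  generalize 1 - z ^ 2 = w at *
  generalize 6 * (μ.re * μ.re + μ.im * μ.im) / ((z - μ.re) ^ 2 + μ.im ^ 2) = c
  field_simp
  ring

/-- The explicit formula bounds |K| by a multiple of w²|F| + |H|, so K F and K²/w² inherit the decay
of the quantities in the hypotheses. -/
lemma tendsto_firstEnergy {l : Filter ℝ} (hl : ∀ᶠ z in l, z ∈ Ioo (-1 : ℝ) 1) (hμ : μ ≠ 0)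
    (h1 : Tendsto (fun z => ‖H z‖ * ‖F z‖) l (𝓝 0))
    (h2 : Tendsto (fun z => (1 - z ^ 2) ^ (0 + 1) * ‖F z‖ ^ 2) l (𝓝 0))
    (h3 : Tendsto (fun z => ‖H z‖ ^ 2 / (1 - z ^ 2) ^ (0 + 2)) l (𝓝 0)) :
    Tendsto (firstEnergy μ F H) l (𝓝 0) := by
  have hm : 0 < ‖μ‖ := norm_pos_iff.2 hμ
  have hK : ∀ z ∈ Ioo (-1 : ℝ) 1, ‖primitive μ F H z‖ ≤
      ((1 - z ^ 2) ^ 2 * ‖F z‖ + (1 + ‖μ‖) * ‖H z‖) / (2 * ‖μ‖) := by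
    intro z hz
    have hw := one_sub_sq_pos hz
    rw [primitive, norm_div, norm_mul 2 μ, Complex.norm_ofNat]
    gcongr
    refine (norm_sub_le _ _).trans ?_
    rw [norm_mul, norm_mul, Complex.norm_of_nonneg (by positivity)]
    gcongr
    refine (norm_sub_le _ _).trans ?_
    gcongr
    rw [Complex.norm_real]
    exact (abs_lt.2 hz).le
  have hKF : Tendsto (fun z => ‖primitive μ F H z‖ * ‖F z‖) l (𝓝 0) := by
    have := (h2.add (h1.const_mul (1 + ‖μ‖))).div_const (2 * ‖μ‖)
    rw [mul_zero, add_zero, zero_div] at this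
    refine squeeze_zero' (.of_forall fun z => by positivity) ?_ this
    filter_upwards [hl] with z hz
    have hw := one_sub_sq_pos hz
    have hw1 : 1 - z ^ 2 ≤ 1 := by nlinarith
    refine (mul_le_mul_of_nonneg_right (hK z hz) (norm_nonneg _)).trans ?_
    rw [div_mul_eq_mul_div, add_mul]
    have : (1 - z ^ 2) ^ 2 * ‖F z‖ * ‖F z‖ ≤ (1 - z ^ 2) ^ (0 + 1) * ‖F z‖ ^ 2 := by
      have : (1 - z ^ 2) ^ 2 ≤ (1 - z ^ 2) ^ (0 + 1) := pow_le_pow_of_le_one hw.le hw1 (by norm_num)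
      nlinarith [sq_nonneg ‖F z‖]
    gcongr ?_ / _
    linarith
  have hKK : Tendsto (fun z => ‖primitive μ F H z‖ ^ 2 / (1 - z ^ 2) ^ 2) l (𝓝 0) := by
    have := ((h2.const_mul 2).add (h3.const_mul (2 * (1 + ‖μ‖) ^ 2))).div_const ((2 * ‖μ‖) ^ 2)
    rw [mul_zero, mul_zero, add_zero, zero_div] at this
    refine squeeze_zero' (.of_forall fun z => by positivity) ?_ this
    filter_upwards [hl] with z hz
    have hw := one_sub_sq_pos hz
    have hw1 : 1 - z ^ 2 ≤ 1 := by nlinarith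
    have hs : ‖primitive μ F H z‖ ^ 2 ≤
        (2 * ((1 - z ^ 2) ^ 2 * ‖F z‖) ^ 2 + 2 * ((1 + ‖μ‖) * ‖H z‖) ^ 2) / (2 * ‖μ‖) ^ 2 := by
      refine (pow_le_pow_left₀ (norm_nonneg _) (hK z hz) 2).trans ?_
      rw [div_pow]
      gcongr
      linarith [sq_nonneg ((1 - z ^ 2) ^ 2 * ‖F z‖ - (1 + ‖μ‖) * ‖H z‖)]
    refine (div_le_div_of_nonneg_right hs (by positivity)).trans ?_
    rw [div_right_comm]
    gcongr ?_ / _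
    rw [add_div]
    gcongr ?_ + ?_
    · rw [show 2 * ((1 - z ^ 2) ^ 2 * ‖F z‖) ^ 2 / (1 - z ^ 2) ^ 2
        = 2 * ((1 - z ^ 2) ^ 2 * ‖F z‖ ^ 2) by field_simp]
      have : (1 - z ^ 2) ^ 2 ≤ (1 - z ^ 2) ^ (0 + 1) := pow_le_pow_of_le_one hw.le hw1 (by norm_num)
      gcongr
    · apply le_of_eq
      field_simp
  have hKK' : Tendsto (fun z => 16 * z * ((primitive μ F H z).re * (primitive μ F H z).re
      + (primitive μ F H z).im * (primitive μ F H z).im) / (1 - z ^ 2) ^ 2) l (𝓝 0) := by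
    have := hKK.const_mul 16
    rw [mul_zero] at this
    refine squeeze_zero_norm' ?_ this
    filter_upwards [hl] with z hz
    rw [← Complex.normSq_apply, ← Complex.sq_norm, norm_div, norm_mul, norm_mul, mul_div_assoc]
    have hz1 : ‖z‖ ≤ 1 := (abs_lt.2 hz).le
    simp only [norm_pow, norm_norm, Real.norm_ofNat]
    rw [← norm_pow ((1 : ℝ) - z ^ 2), Real.norm_of_nonneg (sq_nonneg _)]
    gcongr
    linarith
  have := ((tendsto_energy (μ := μ) h1).add ((tendsto_re_mul_conj hKF).const_mul 8)).add hKK'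
  rw [mul_zero, add_zero, add_zero] at this
  exact this

lemma eq_zero_of_im_ne_zero_of_first (S : ModeODE 0 μ F H) (hμ : μ.im ≠ 0) :
    ∀ z ∈ Ioo (-1 : ℝ) 1, F z = 0 := by
  have hμ0 : μ ≠ 0 := fun e => hμ (by rw [e]; rfl)
  intro z hz
  have key := deriv_eq_zero_of_nonneg_of_tendsto (fun z hz => S.hasDerivAt_firstEnergy hμ hz)
    (fun z hz => by
      have hw := one_sub_sq_pos hz
      positivity)
    (tendsto_firstEnergy eventually_mem_nhdsGT hμ0 S.mul_left S.sq_left S.flux_left)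
    (tendsto_firstEnergy eventually_mem_nhdsLT hμ0 S.mul_right S.sq_right S.flux_right) z hz
  have hw := one_sub_sq_pos hz
  by_contra hF
  have : 0 < ‖F z‖ := norm_pos_iff.2 hF
  refine ne_of_gt ?_ key
  positivity

lemma re (S : ModeODE n μ F H) (hμ : μ.im = 0) :
    RealModeODE n μ.re (fun z => (F z).re) (fun z => (H z).re) := by
  have hμr : μ = (μ.re : ℂ) := Complex.ext rfl (by simpa using hμ)
  constructor
  · intro z hz
    exact (S.deriv_F z hz).complex_re.congr_deriv (Complex.div_ofReal_re _ _)
  · intro z hz hne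
    have hne' : (z : ℂ) ≠ μ := fun e => hne (by rw [← e]; rfl)
    refine (S.deriv_H z hz hne').complex_re.congr_deriv ?_
    rw [re_flux_coeff, hμ]
    have : z - μ.re ≠ 0 := sub_ne_zero.2 hne
    field_simp
    ring
  · exact Complex.continuous_re.comp_continuousOn S.cont_H
  · exact tendsto_mul_of_norm Complex.abs_re_le_norm Complex.abs_re_le_norm S.mul_left
  · exact tendsto_mul_of_norm Complex.abs_re_le_norm Complex.abs_re_le_norm S.mul_right
  · refine squeeze_zero' ?_ ?_ S.sq_left
    all_goals
      filter_upwards [eventually_mem_nhdsGT] with z hz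
      have hw := one_sub_sq_pos hz
    · positivity
    · rw [← sq_abs (F z).re]
      gcongr
      exact Complex.abs_re_le_norm _
  · refine squeeze_zero' ?_ ?_ S.sq_right
    all_goals
      filter_upwards [eventually_mem_nhdsLT] with z hz
      have hw := one_sub_sq_pos hz
    · positivity
    · rw [← sq_abs (F z).re]
      gcongr
      exact Complex.abs_re_le_norm _
  · intro h
    simp [S.vanish _ h hμr.symm]

lemma const_mul (S : ModeODE n μ F H) (c : ℂ) :
    ModeODE n μ (fun z => c * F z) (fun z => c * H z) := by
  constructor
  · intro z hz
    exact ((S.deriv_F z hz).const_mul c).congr_deriv (by ring)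
  · intro z hz hne
    exact ((S.deriv_H z hz hne).const_mul c).congr_deriv (by ring)
  · exact S.cont_H.const_smul c
  · have := S.mul_left.const_mul (‖c‖ ^ 2)
    rw [mul_zero] at this
    exact this.congr fun z => by simp only [norm_mul]; ring
  · have := S.mul_right.const_mul (‖c‖ ^ 2)
    rw [mul_zero] at this
    exact this.congr fun z => by simp only [norm_mul]; ring
  · have := S.sq_left.const_mul (‖c‖ ^ 2)
    rw [mul_zero] at this
    exact this.congr fun z => by simp only [norm_mul]; ring
  · have := S.sq_right.const_mul (‖c‖ ^ 2)
    rw [mul_zero] at this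
    exact this.congr fun z => by simp only [norm_mul]; ring
  · have := S.flux_left.const_mul (‖c‖ ^ 2)
    rw [mul_zero] at this
    exact this.congr fun z => by simp only [norm_mul]; ring
  · have := S.flux_right.const_mul (‖c‖ ^ 2)
    rw [mul_zero] at this
    exact this.congr fun z => by simp only [norm_mul]; ring
  · intro x hx e
    simp [S.vanish x hx e]

/-- The eigenvalue equation in a nonzero longitudinal mode has no nontrivial solution. -/
theorem eq_zero (S : ModeODE n μ F H) (hμ : μ ≠ 0) : ∀ z ∈ Ioo (-1 : ℝ) 1, F z = 0 := by
  by_cases hi : μ.im = 0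
  · have hr : μ.re ≠ 0 := fun h => hμ (Complex.ext h hi)
    intro z hz
    have h1 := (S.re hi).eq_zero hr z hz
    -- The real part of iF is -Im F, so the imaginary part is covered by the real case.
    have h2 := ((S.const_mul Complex.I).re hi).eq_zero hr z hz
    exact Complex.ext h1 (by simpa using h2)
  · rcases Nat.eq_zero_or_pos n with h0 | h0
    · subst h0
      exact S.eq_zero_of_im_ne_zero_of_first hi
    · exact S.eq_zero_of_im_ne_zero_of_pos hi h0

end ModeODE

/-! ### Integration by parts and weak derivatives on an interval -/

/-- Integration by parts for the primitive of an integrable function and a smooth function. -/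
lemma integral_mul_eq_neg_integral_primitive_mul {a b : ℝ} {G : ℝ → ℂ}
    (hG : IntervalIntegrable G volume a b) (hG0 : ∫ t in a..b, G t = 0) {p : ℝ → ℝ}
    (hp : ContDiff ℝ 1 p) :
    ∫ z in a..b, G z * p z = -∫ z in a..b, (∫ t in a..z, G t) * deriv p z := by
  -- The primitive of an integrable function is only absolutely continuous; the real-valued formula
  -- for such functions is applied to real and imaginary parts.
  have hreal : ∀ g : ℝ → ℝ, IntervalIntegrable g volume a b → ∫ t in a..b, g t = 0 →
      ∫ z in a..b, g z * p z = -∫ z in a..b, (∫ t in a..z, g t) * deriv p z := by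
    intro g hg hg0
    have h1 := (hg.absolutelyContinuousOnInterval_intervalIntegral (c := a)
      (by simp)).integral_mul_deriv_eq_deriv_mul (hp.contDiffOn.absolutelyContinuousOnInterval)
    rw [hg0, intervalIntegral.integral_same, zero_mul, zero_mul, sub_zero, zero_sub] at h1
    rw [h1, neg_neg]
    refine intervalIntegral.integral_congr_ae ?_
    filter_upwards [hg.ae_hasDerivAt_integral] with z hz hz'
    rw [(hz (uIoc_subset_uIcc hz') a (by simp)).deriv]
  have hre : ∀ z ∈ uIcc a b, (∫ t in a..z, G t).re = ∫ t in a..z, (G t).re := fun z hz =>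
    (Complex.reCLM.intervalIntegral_comp_comm
      (hG.mono_set (uIcc_subset_uIcc_left hz))).symm
  have him : ∀ z ∈ uIcc a b, (∫ t in a..z, G t).im = ∫ t in a..z, (G t).im := fun z hz =>
    (Complex.imCLM.intervalIntegral_comp_comm
      (hG.mono_set (uIcc_subset_uIcc_left hz))).symm
  have hGre : IntervalIntegrable (fun z => (G z).re) volume a b :=
    ⟨hG.1.re, hG.2.re⟩
  have hGim : IntervalIntegrable (fun z => (G z).im) volume a b :=
    ⟨hG.1.im, hG.2.im⟩
  have i1 : IntervalIntegrable (fun z => G z * p z) volume a b :=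
    hG.mul_continuousOn (Complex.continuous_ofReal.comp hp.continuous).continuousOn
  have i2 : IntervalIntegrable (fun z => (∫ t in a..z, G t) * deriv p z) volume a b := by
    refine ContinuousOn.intervalIntegrable ?_
    exact (intervalIntegral.continuousOn_primitive_interval' hG (by simp)).mul
      (Complex.continuous_ofReal.comp (hp.continuous_deriv le_rfl)).continuousOn
  have r1 := Complex.reCLM.intervalIntegral_comp_comm i1
  have r2 := Complex.reCLM.intervalIntegral_comp_comm i2
  have m1 := Complex.imCLM.intervalIntegral_comp_comm i1
  have m2 := Complex.imCLM.intervalIntegral_comp_comm i2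
  simp only [Complex.reCLM_apply, Complex.imCLM_apply, Complex.re_mul_ofReal,
    Complex.im_mul_ofReal] at r1 r2 m1 m2
  apply Complex.ext
  · rw [Complex.neg_re, ← r1, ← r2, hreal _ hGre (by rw [← hre b (by simp), hG0]; rfl)]
    congr 1
    refine intervalIntegral.integral_congr fun z hz => ?_
    simp only [hre z hz]
  · rw [Complex.neg_im, ← m1, ← m2, hreal _ hGim (by rw [← him b (by simp), hG0]; rfl)]
    congr 1
    refine intervalIntegral.integral_congr fun z hz => ?_
    simp only [him z hz]

/-- A compactly supported smooth function of mean zero on an interval has a compactly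
supported smooth primitive. -/
lemma exists_primitive_of_integral_eq_zero {χ : ℝ → ℝ} (hχ : ContDiff ℝ ∞ χ) {r : ℝ} (hr : 0 < r)
    (hsupp : ∀ z, z ∉ Ioo (-r) r → χ z = 0) (h0 : ∫ z, χ z = 0) :
    ∃ X : ℝ → ℝ, ContDiff ℝ ∞ X ∧ (∀ z, HasDerivAt X (χ z) z) ∧ ∀ z, z ∉ Ioo (-r) r → X z = 0 := by
  have hd : ∀ z, HasDerivAt (fun z => ∫ t in (-r)..z, χ t) (χ z) z := fun z =>
    hχ.continuous.integral_hasStrictDerivAt _ _ |>.hasDerivAt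
  refine ⟨fun z => ∫ t in (-r)..z, χ t, ?_, hd, ?_⟩
  · rw [contDiff_infty_iff_deriv]
    exact ⟨fun z => (hd z).differentiableAt, by rwa [funext fun z => (hd z).deriv]⟩
  · intro z hz
    have hcases : z ≤ -r ∨ r ≤ z := by
      by_contra! h
      exact hz h
    change ∫ t in (-r)..z, χ t = 0
    rcases hcases with h | h
    · rw [intervalIntegral.integral_symm, intervalIntegral.integral_of_le h,
        setIntegral_eq_zero_of_forall_eq_zero, neg_zero]
      exact fun t ht => hsupp t fun h' => absurd h'.1 (not_lt.2 ht.2)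
    · rw [intervalIntegral.integral_of_le (by linarith), ← h0]
      refine setIntegral_eq_integral_of_forall_compl_eq_zero fun t ht => hsupp t fun h' => ht ?_
      exact ⟨h'.1, (h'.2.trans_le h).le⟩

lemma exists_Ioo_of_tsupport_subset {χ : ℝ → ℝ} (h : tsupport χ ⊆ Ioo (-1) 1) :
    ∃ r, 0 < r ∧ r < 1 ∧ ∀ z, z ∉ Ioo (-r) r → χ z = 0 := by
  have e : ∀ r : ℝ, Metric.ball (0 : ℝ) r = Ioo (-r) r := fun r => by
    rw [Real.ball_eq_Ioo, zero_sub, zero_add]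
  rw [← e] at h
  obtain ⟨r, hr, hsub⟩ := exists_pos_lt_subset_ball one_pos (isClosed_tsupport χ) h
  rw [e] at hsub
  exact ⟨r, hr.1, hr.2, fun z hz => image_eq_zero_of_notMem_tsupport fun h' => hz (hsub h')⟩

lemma integrable_smul_of_tsupport_subset {f : ℝ → ℂ} (hf : LocallyIntegrableOn f (Ioo (-1) 1))
    {g : ℝ → ℝ} (hg : Continuous g) (hgt : tsupport g ⊆ Ioo (-1) 1) :
    Integrable (fun z => g z • f z) := by
  have hgc : IsCompact (tsupport g) :=
    Metric.isCompact_of_isClosed_isBounded (isClosed_tsupport g) ((Metric.isBounded_Ioo (-1) 1).subset hgt)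
  have := (hf.integrableOn_compact_subset hgt hgc).continuousOn_smul hg.continuousOn hgc
  exact (integrableOn_iff_integrable_of_support_subset fun z hz => subset_tsupport g fun h0 =>
    hz (by simp [h0])).1 this

/-- The lemma of du Bois-Reymond. -/
lemma ae_eq_const_of_integral_smul_eq_zero {f : ℝ → ℂ}
    (hf : LocallyIntegrableOn f (Ioo (-1) 1))
    (h : ∀ χ : ℝ → ℝ, ContDiff ℝ ∞ χ → tsupport χ ⊆ Ioo (-1) 1 → ∫ z, χ z = 0 →
      ∫ z, χ z • f z = 0) :
    ∃ c, ∀ᵐ z, z ∈ Ioo (-1 : ℝ) 1 → f z = c := by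
  let η : ContDiffBump (0 : ℝ) := ⟨1 / 4, 1 / 2, by norm_num, by norm_num⟩
  set e : ℝ → ℝ := η.normed volume with he
  have hes : ContDiff ℝ ∞ e := η.contDiff_normed
  have hec : HasCompactSupport e := η.hasCompactSupport_normed
  have hei : ∫ z, e z = 1 := η.integral_normed
  have het : tsupport e ⊆ Ioo (-1) 1 := by
    rw [he, η.tsupport_normed_eq, Real.closedBall_eq_Icc]
    intro z hz
    have : η.rOut = 1 / 2 := rfl
    rw [this] at hz
    exact ⟨by linarith [hz.1], by linarith [hz.2]⟩
  refine ⟨∫ z, e z • f z, ?_⟩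
  set c := ∫ z, e z • f z with hc
  have := IsOpen.ae_eq_zero_of_integral_contDiff_smul_eq_zero (μ := volume) isOpen_Ioo
    (f := fun z => f z - c) (hf.sub ((locallyIntegrable_const c).locallyIntegrableOn _)) ?_
  · filter_upwards [this] with z hz hz'
    exact sub_eq_zero.1 (hz hz')
  · intro g hg hgc hgt
    have hgi := hg.continuous.integrable_of_hasCompactSupport (μ := volume) hgc
    have hei' := hes.continuous.integrable_of_hasCompactSupport (μ := volume) hec
    -- Subtracting a multiple of the bump e of integral 1 makes an arbitrary test function g
    -- admissible; the constant is then the mean of f against e.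
    have key := h (fun z => g z - (∫ t, g t) * e z) (hg.sub (contDiff_const.mul hes)) ?_ ?_
    · simp only [sub_smul, mul_smul] at key
      have hi : Integrable (fun z => (∫ t, g t) • e z • f z) :=
        (integrable_smul_of_tsupport_subset hf hes.continuous het).smul (∫ t, g t)
      rw [integral_sub (integrable_smul_of_tsupport_subset hf hg.continuous hgt) hi, integral_smul, ← hc] at key
      simp only [smul_sub]
      rw [integral_sub (integrable_smul_of_tsupport_subset hf hg.continuous hgt) (hgi.smul_const c), integral_smul_const, key]
    · refine (tsupport_sub _ _).trans (union_subset hgt ?_)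
      exact (closure_mono (Function.support_mul_subset_right _ _)).trans het
    · rw [integral_sub hgi (hei'.const_mul _), integral_const_mul, hei, mul_one, sub_self]


/-! ### From the weak equation of a mode to its profile and flux -/

/-- The weak form of `Δ v = u` in the longitudinal mode `n + 1`, for `v = V(z) e^{i(n+1)φ}`,
`u = U(z) e^{i(n+1)φ}` and the test functions `(1 - z²)^((n+1)/2) p(z) e^{-i(n+1)φ}`. -/
structure WeakMode (n : ℕ) (U V : ℝ → ℂ) : Prop where
  memU : MemLp U 2 (volume.restrict (Ioo (-1) 1))
  memV : MemLp V 2 (volume.restrict (Ioo (-1) 1))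
  weak : ∀ p : ℝ → ℝ, ContDiff ℝ ∞ p →
    ∫ z in Ioo (-1 : ℝ) 1, V z * ((√(1 - z ^ 2) ^ (n + 1) * ((1 - z ^ 2) * deriv (deriv p) z
        - 2 * (n + 2) * z * deriv p z - (n + 1) * (n + 2) * p z) : ℝ) : ℂ)
      = ∫ z in Ioo (-1 : ℝ) 1, U z * ((√(1 - z ^ 2) ^ (n + 1) * p z : ℝ) : ℂ)

/-- `u + (n+1)(n+2) v`, in terms of the profiles. -/
def shifted (n : ℕ) (U V : ℝ → ℂ) (z : ℝ) : ℂ := U z + (((n + 1) * (n + 2) : ℝ) : ℂ) * V z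

/-- The density of the flux. -/
def source (n : ℕ) (U V : ℝ → ℂ) (z : ℝ) : ℂ :=
  ((√(1 - z ^ 2) ^ (n + 1) : ℝ) : ℂ) * shifted n U V z

/-- The flux `(1 - z²)^(n+2) F'`. -/
def flux (n : ℕ) (U V : ℝ → ℂ) (z : ℝ) : ℂ := ∫ t in (-1)..z, source n U V t

/-- The primitive of `F'` that vanishes at the equator. -/
def profile (n : ℕ) (U V : ℝ → ℂ) (z : ℝ) : ℂ :=
  ∫ t in (0 : ℝ)..z, flux n U V t / (((1 - t ^ 2) ^ (n + 2) : ℝ) : ℂ)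

lemma sqrt_pow_mul_self (k : ℕ) {z : ℝ} (hz : z ∈ Ioo (-1 : ℝ) 1) :
    √(1 - z ^ 2) ^ k * √(1 - z ^ 2) ^ k = (1 - z ^ 2) ^ k := by
  rw [← mul_pow, Real.mul_self_sqrt (one_sub_sq_pos hz).le]

/-- The second order operator of the mode in divergence form, applied to a primitive of
`X / (1 - z²)^(n+2)`. -/
lemma exists_test_function (n : ℕ) {X χ : ℝ → ℝ} (hX : ContDiff ℝ ∞ X)
    (hd : ∀ z, HasDerivAt X (χ z) z) {r : ℝ} (hr : r < 1)
    (hsupp : ∀ z, z ∉ Ioo (-r) r → X z = 0) :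
    ∃ p : ℝ → ℝ, ContDiff ℝ ∞ p ∧ (deriv p = fun z => X z / (1 - z ^ 2) ^ (n + 2)) ∧
      ∀ z ∈ Ioo (-1 : ℝ) 1, (1 - z ^ 2) * deriv (deriv p) z - 2 * (n + 2) * z * deriv p z
        = χ z / (1 - z ^ 2) ^ (n + 1) := by
  set q : ℝ → ℝ := fun z => X z / (1 - z ^ 2) ^ (n + 2) with hq
  have hqs : ContDiff ℝ ∞ q := by
    rw [contDiff_iff_contDiffAt]
    intro z
    by_cases hz : z ∈ Ioo (-1 : ℝ) 1
    · exact hX.contDiffAt.div (by fun_prop) (pow_ne_zero _ (one_sub_sq_pos hz).ne')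
    -- At and beyond the poles the denominator is no obstacle, since X vanishes outside a smaller
    -- interval.
    · have h1 : z ∉ Icc (-r) r := fun h => hz ⟨by linarith [h.1], by linarith [h.2]⟩
      refine (contDiffAt_const (c := (0 : ℝ))).congr_of_eventuallyEq ?_
      filter_upwards [isClosed_Icc.isOpen_compl.mem_nhds h1] with t ht
      rw [hq]
      simp only [hsupp t fun h' => ht ⟨h'.1.le, h'.2.le⟩, zero_div]
  have hpd : ∀ z, HasDerivAt (fun z => ∫ t in (0 : ℝ)..z, q t) (q z) z := fun z =>
    (hqs.continuous.integral_hasStrictDerivAt _ _).hasDerivAt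
  have hpd' : deriv (fun z => ∫ t in (0 : ℝ)..z, q t) = q := funext fun z => (hpd z).deriv
  refine ⟨fun z => ∫ t in (0 : ℝ)..z, q t, ?_, hpd', ?_⟩
  · rw [contDiff_infty_iff_deriv, hpd']
    exact ⟨fun z => (hpd z).differentiableAt, hqs⟩
  · intro z hz
    have hw := (one_sub_sq_pos hz).ne'
    have := (hd z).div (hasDerivAt_one_sub_sq_pow (n + 1) z) (pow_ne_zero _ hw)
    rw [hpd', show deriv q z = _ from this.deriv, hq]
    push_cast
    field_simp
    ring

namespace WeakMode

variable {n : ℕ} {U V : ℝ → ℂ}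

lemma memLp_shifted (S : WeakMode n U V) :
    MemLp (shifted n U V) 2 (volume.restrict (Ioo (-1) 1)) :=
  S.memU.add (S.memV.const_mul _)

lemma integrable_mul_ofReal {f : ℝ → ℂ} (hf : IntegrableOn f (Ioo (-1) 1)) {g : ℝ → ℝ}
    (hg : Continuous g) : IntegrableOn (fun z => f z * (g z : ℂ)) (Ioo (-1) 1) := by
  have hf' : IntegrableOn f (Icc (-1) 1) := by
    rwa [integrableOn_Icc_iff_integrableOn_Ioo]
  exact (hf'.mul_continuousOn (Complex.continuous_ofReal.comp hg).continuousOn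
    isCompact_Icc).mono_set Ioo_subset_Icc_self

lemma integrableOn_of_memLp {f : ℝ → ℂ} (hf : MemLp f 2 (volume.restrict (Ioo (-1) 1))) :
    IntegrableOn f (Ioo (-1) 1) :=
  hf.integrable (by norm_num)

lemma integrableOn_source (S : WeakMode n U V) : IntegrableOn (source n U V) (Ioo (-1) 1) := by
  have := integrable_mul_ofReal (integrableOn_of_memLp S.memLp_shifted)
    (g := fun z => √(1 - z ^ 2) ^ (n + 1)) (by fun_prop)
  exact this.congr_fun (fun z _ => mul_comm _ _) measurableSet_Ioo

lemma intervalIntegrable_source (S : WeakMode n U V) :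
    IntervalIntegrable (source n U V) volume (-1) 1 :=
  (intervalIntegrable_iff_integrableOn_Ioo_of_le (by norm_num)).2 S.integrableOn_source

lemma integral_Ioo_eq {f : ℝ → ℂ} : ∫ z in Ioo (-1 : ℝ) 1, f z = ∫ z in (-1)..1, f z := by
  rw [intervalIntegral.integral_of_le (by norm_num), integral_Ioc_eq_integral_Ioo]

/-- Moving the zero-order term to the right replaces U by U + (n+1)(n+2)V and leaves the operator in
divergence form, w^(-(n+1)) (w^(n+2) p')'. -/
lemma integral_source_mul (S : WeakMode n U V) {p : ℝ → ℝ} (hp : ContDiff ℝ ∞ p) :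
    ∫ z in Ioo (-1 : ℝ) 1, V z * ((√(1 - z ^ 2) ^ (n + 1) * ((1 - z ^ 2) * deriv (deriv p) z
        - 2 * (n + 2) * z * deriv p z) : ℝ) : ℂ) = ∫ z in Ioo (-1 : ℝ) 1, source n U V z * p z := by
  have hc1 : Continuous (deriv p) := hp.continuous_deriv (by simp)
  have hc2 : Continuous (deriv (deriv p)) :=
    ((contDiff_infty_iff_deriv.1 hp).2).continuous_deriv (by simp)
  have hc := hp.continuous
  have iU := integrableOn_of_memLp S.memU
  have iV := integrableOn_of_memLp S.memV
  have i1 := integrable_mul_ofReal iV (g := fun z => √(1 - z ^ 2) ^ (n + 1) *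
    ((1 - z ^ 2) * deriv (deriv p) z - 2 * (n + 2) * z * deriv p z - (n + 1) * (n + 2) * p z))
    (by fun_prop)
  have i2 := integrable_mul_ofReal iV (g := fun z => √(1 - z ^ 2) ^ (n + 1) *
    ((n + 1) * (n + 2) * p z)) (by fun_prop)
  have i3 := integrable_mul_ofReal iU (g := fun z => √(1 - z ^ 2) ^ (n + 1) * p z) (by fun_prop)
  have e1 : ∫ z in Ioo (-1 : ℝ) 1, V z * ((√(1 - z ^ 2) ^ (n + 1) * ((1 - z ^ 2) * deriv (deriv p) z
        - 2 * (n + 2) * z * deriv p z) : ℝ) : ℂ) = (∫ z in Ioo (-1 : ℝ) 1, V z *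
        ((√(1 - z ^ 2) ^ (n + 1) * ((1 - z ^ 2) * deriv (deriv p) z
        - 2 * (n + 2) * z * deriv p z - (n + 1) * (n + 2) * p z) : ℝ) : ℂ))
        + ∫ z in Ioo (-1 : ℝ) 1, V z * ((√(1 - z ^ 2) ^ (n + 1) *
    ((n + 1) * (n + 2) * p z) : ℝ) : ℂ) := by
    rw [← integral_add i1 i2]
    congr 1 with z
    push_cast
    ring
  rw [e1, S.weak p hp, ← integral_add i3 i2]
  congr 1 with z
  simp only [source, shifted]
  push_cast
  ring

/-- The test function p = 1 kills the operator in divergence form. The flux therefore vanishes at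
both poles, which is how testing on the closed sphere enters as a boundary condition. -/
lemma integral_source (S : WeakMode n U V) : ∫ z in (-1)..1, source n U V z = 0 := by
  have := S.integral_source_mul (p := fun _ => 1) contDiff_const
  simp only [deriv_const', deriv_const, mul_zero, sub_zero, Complex.ofReal_zero, integral_zero,
    Complex.ofReal_one, mul_one] at this
  rw [← integral_Ioo_eq, ← this]

lemma continuousOn_flux_Icc (S : WeakMode n U V) : ContinuousOn (flux n U V) (Icc (-1) 1) := by
  have := intervalIntegral.continuousOn_primitive_interval' S.intervalIntegrable_source
    (a := -1) (by simp)
  rwa [uIcc_of_le (by norm_num)] at this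

lemma hasDerivAt_profile (S : WeakMode n U V) {z : ℝ} (hz : z ∈ Ioo (-1 : ℝ) 1) :
    HasDerivAt (profile n U V) (flux n U V z / (((1 - z ^ 2) ^ (n + 2) : ℝ) : ℂ)) z := by
  have hc : ContinuousOn (fun t : ℝ => flux n U V t / (((1 - t ^ 2) ^ (n + 2) : ℝ) : ℂ))
      (Ioo (-1) 1) := by
    refine (S.continuousOn_flux_Icc.mono Ioo_subset_Icc_self).div
      (Complex.continuous_ofReal.comp (by fun_prop)).continuousOn fun t ht => ?_
    exact_mod_cast (pow_pos (one_sub_sq_pos ht) _).ne'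
  have hsub : uIcc 0 z ⊆ Ioo (-1) 1 :=
    ordConnected_Ioo.uIcc_subset (by norm_num) hz
  refine intervalIntegral.integral_hasDerivAt_right ((hc.mono hsub).intervalIntegrable)
    (hc.stronglyMeasurableAtFilter isOpen_Ioo z hz) (hc.continuousAt (isOpen_Ioo.mem_nhds hz))

/-- For χ of mean zero there is a smooth p with (w^(n+2) p')' = χ on (-1, 1). Testing with it and
integrating by parts twice shows that w^(-(n+1)/2) V and the profile have the same integral against
χ; du Bois-Reymond then gives the constant. -/
lemma ae_eq_profile (S : WeakMode n U V) : ∃ c, ∀ᵐ z, z ∈ Ioo (-1 : ℝ) 1 →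
    V z = ((√(1 - z ^ 2) ^ (n + 1) : ℝ) : ℂ) * (profile n U V z + c) := by
  have hcP : ContinuousOn (profile n U V) (Ioo (-1) 1) := fun z hz =>
    (S.hasDerivAt_profile hz).continuousAt.continuousWithinAt
  have hs : ∀ z ∈ Ioo (-1 : ℝ) 1, ((√(1 - z ^ 2) ^ (n + 1) : ℝ) : ℂ) ≠ 0 := fun z hz => by
    exact_mod_cast (pow_pos (Real.sqrt_pos.2 (one_sub_sq_pos hz)) _).ne'
  have hloc1 : LocallyIntegrableOn (fun z => (((√(1 - z ^ 2) ^ (n + 1) : ℝ) : ℂ))⁻¹ * V z)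
      (Ioo (-1) 1) := by
    refine (integrableOn_of_memLp S.memV).locallyIntegrableOn.continuousOn_mul ?_
      isOpen_Ioo.isLocallyClosed
    exact (Complex.continuous_ofReal.comp (by fun_prop)).continuousOn.inv₀ hs
  have hloc2 : LocallyIntegrableOn (profile n U V) (Ioo (-1) 1) :=
    hcP.locallyIntegrableOn measurableSet_Ioo
  refine Exists.imp (fun c hc => ?_)
    (ae_eq_const_of_integral_smul_eq_zero (hloc1.sub hloc2) ?_)
  · filter_upwards [hc] with z hz hz'
    rw [← hz hz', Pi.sub_apply]
    have := hs z hz'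
    field_simp
    ring
  intro χ hχ hχt hχ0
  obtain ⟨r, hr0, hr1, hχr⟩ := exists_Ioo_of_tsupport_subset hχt
  obtain ⟨X, hX, hXd, hXr⟩ := exists_primitive_of_integral_eq_zero hχ hr0 hχr hχ0
  obtain ⟨p, hp, hp1, hp2⟩ := exists_test_function n hX hXd hr1 hXr
  have hrI : Icc (-r) r ⊆ Ioo (-1) 1 := fun z hz => ⟨by linarith [hz.1], by linarith [hz.2]⟩
  have hI : ∀ z, z ∉ Ioo (-1 : ℝ) 1 → z ∉ Ioo (-r) r := fun z hz h =>
    hz (hrI (Ioo_subset_Icc_self h))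
  have h1 := S.integral_source_mul hp
  have h2 := integral_mul_eq_neg_integral_primitive_mul S.intervalIntegrable_source
    S.integral_source (hp.of_le (by simp) : ContDiff ℝ 1 p)
  rw [integral_Ioo_eq (f := fun z => source n U V z * p z), h2] at h1
  -- With X = w^(n+2) p', the function flux · p' is the derivative of the profile times X, and X
  -- vanishes at ±r.
  have h3 : ∫ z in (-r)..r, profile n U V z * (χ z : ℂ) =
      -∫ z in (-1)..1, (∫ t in (-1)..z, source n U V t) * ((deriv p z : ℝ) : ℂ) := by
    have := intervalIntegral.integral_mul_deriv_eq_deriv_mul (a := -r) (b := r)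
      (u := profile n U V) (v := fun z => (X z : ℂ)) (v' := fun z => (χ z : ℂ))
      (u' := fun z => flux n U V z / (((1 - z ^ 2) ^ (n + 2) : ℝ) : ℂ))
      (fun z hz => S.hasDerivAt_profile (hrI (by rwa [uIcc_of_le (by linarith)] at hz)))
      (fun z _ => (hXd z).ofReal_comp) ?_
      (Complex.continuous_ofReal.comp hχ.continuous).continuousOn.intervalIntegrable
    · rw [this, hXr r (by simp), hXr (-r) (by simp), Complex.ofReal_zero, mul_zero, mul_zero,
        sub_zero, zero_sub, hp1, intervalIntegral.integral_of_le (by linarith),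
        intervalIntegral.integral_of_le (by norm_num)]
      congr 1
      rw [setIntegral_eq_integral_of_forall_compl_eq_zero,
        setIntegral_eq_integral_of_forall_compl_eq_zero]
      · congr 1 with z
        rw [flux]
        push_cast
        ring
      · intro z hz
        beta_reduce
        rw [hXr z fun h => hI z (fun h' => hz ⟨h'.1, h'.2.le⟩) h]
        simp
      · intro z hz
        rw [hXr z fun h => hz ⟨h.1, h.2.le⟩]
        simp
    · refine ContinuousOn.intervalIntegrable ?_
      rw [uIcc_of_le (by linarith)]
      refine (S.continuousOn_flux_Icc.mono (hrI.trans Ioo_subset_Icc_self)).div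
        (Complex.continuous_ofReal.comp (by fun_prop)).continuousOn fun t ht => ?_
      exact_mod_cast (pow_pos (one_sub_sq_pos (hrI ht)) _).ne'
  rw [← h3] at h1
  simp only [Pi.sub_apply, smul_sub]
  rw [integral_sub (integrable_smul_of_tsupport_subset hloc1 hχ.continuous hχt)
    (integrable_smul_of_tsupport_subset hloc2 hχ.continuous hχt), sub_eq_zero]
  refine Eq.trans ?_ (h1.trans ?_)
  · rw [← setIntegral_eq_integral_of_forall_compl_eq_zero (s := Ioo (-1) 1)]
    · refine setIntegral_congr_fun measurableSet_Ioo fun z hz => ?_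
      simp only [hp2 z hz, ← sqrt_pow_mul_self (n + 1) hz, Complex.real_smul]
      have := hs z hz
      push_cast at this ⊢
      field_simp
    · intro z hz
      rw [hχr z (hI z hz), zero_smul]
  · rw [intervalIntegral.integral_of_le (by linarith),
      setIntegral_eq_integral_of_forall_compl_eq_zero]
    · congr 1 with z
      rw [Complex.real_smul, mul_comm]
    · intro z hz
      rw [hχr z fun h => hz ⟨h.1, h.2.le⟩]
      simp

end WeakMode

/-! ### Decay at the poles and the classical equation -/

lemma norm_integral_sq_le {α : Type*} [MeasurableSpace α] {ν : Measure α} [IsFiniteMeasure ν]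
    {G : α → ℂ} (hG : MemLp G 2 ν) :
    ‖∫ x, G x ∂ν‖ ^ 2 ≤ ν.real univ * ∫ x, ‖G x‖ ^ 2 ∂ν := by
  have h1 : Integrable (fun x => ‖G x‖) ν := (hG.integrable (by norm_num)).norm
  have h2 : Integrable (fun x => ‖G x‖ ^ 2) ν := hG.integrable_norm_pow (by norm_num)
  set a := ∫ x, ‖G x‖ ∂ν with ha
  set v := ν.real univ with hv
  have hle : ‖∫ x, G x ∂ν‖ ^ 2 ≤ a ^ 2 :=
    pow_le_pow_left₀ (norm_nonneg _) (norm_integral_le_integral_norm G) 2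
  refine hle.trans ?_
  have key : 0 ≤ ∫ x, (v * ‖G x‖ - a) ^ 2 ∂ν := integral_nonneg fun x => sq_nonneg _
  have e : ∫ x, (v * ‖G x‖ - a) ^ 2 ∂ν = v ^ 2 * ∫ x, ‖G x‖ ^ 2 ∂ν - v * a ^ 2 := by
    have : ∀ x, (v * ‖G x‖ - a) ^ 2 = v ^ 2 * ‖G x‖ ^ 2 - 2 * v * a * ‖G x‖ + a ^ 2 := fun x => by
      ring
    simp only [this]
    have h3 : Integrable (fun x => v ^ 2 * ‖G x‖ ^ 2 - 2 * v * a * ‖G x‖) ν :=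
      (h2.const_mul _).sub (h1.const_mul _)
    rw [integral_add h3 (integrable_const _),
      integral_sub (h2.const_mul _) (h1.const_mul _), integral_const_mul, integral_const_mul,
      integral_const, ← ha, ← hv, smul_eq_mul]
    ring
  rw [e] at key
  rcases (measureReal_nonneg : 0 ≤ v).eq_or_lt with h0 | h0
  · have : ν = 0 := by
      rw [← Measure.measure_univ_eq_zero, ← measureReal_eq_zero_iff]
      exact h0.symm
    simp [ha, this]
  · have : v * a ^ 2 ≤ v * (v * ∫ x, ‖G x‖ ^ 2 ∂ν) := by nlinarith
    exact le_of_mul_le_mul_left this h0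

/-- Behaviour at the pole `z = -1` of a function with small flux. -/
lemma tendsto_at_pole {n : ℕ} {F H : ℝ → ℂ} {B : ℝ → ℝ}
    (hF : ∀ z ∈ Ioo (-1 : ℝ) 1, HasDerivAt F (H z / (((1 - z ^ 2) ^ (n + 2) : ℝ) : ℂ)) z)
    (hH : ∀ z ∈ Ioo (-1 : ℝ) 0, ‖H z‖ ^ 2 ≤ (1 + z) ^ (n + 2) * B z)
    (hB : Tendsto B (𝓝[>] (-1)) (𝓝 0)) :
    Tendsto (fun z => ‖H z‖ ^ 2 / (1 - z ^ 2) ^ (n + 2)) (𝓝[>] (-1)) (𝓝 0) ∧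
    Tendsto (fun z => (1 - z ^ 2) ^ (n + 1) * ‖F z‖ ^ 2) (𝓝[>] (-1)) (𝓝 0) ∧
    Tendsto (fun z => ‖H z‖ * ‖F z‖) (𝓝[>] (-1)) (𝓝 0) := by
  have hneg : ∀ᶠ z in 𝓝[>] (-1 : ℝ), z ∈ Ioo (-1 : ℝ) 0 := Ioo_mem_nhdsGT (by norm_num)
  have hx : ∀ z ∈ Ioo (-1 : ℝ) 0, 0 < 1 + z ∧ 1 + z ≤ 1 - z ^ 2 ∧ 1 - z ^ 2 ≤ 2 * (1 + z) ∧
      1 - z ^ 2 ≤ 1 := fun z hz =>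
    ⟨by linarith [hz.1], by nlinarith [hz.1, hz.2], by nlinarith [hz.1, hz.2], by nlinarith⟩
  have h1 : Tendsto (fun z => ‖H z‖ ^ 2 / (1 - z ^ 2) ^ (n + 2)) (𝓝[>] (-1)) (𝓝 0) := by
    refine squeeze_zero' ?_ ?_ hB
    · filter_upwards [hneg] with z hz
      obtain ⟨a1, a2, -, -⟩ := hx z hz
      have : 0 < 1 - z ^ 2 := a1.trans_le a2
      positivity
    · filter_upwards [hneg] with z hz
      obtain ⟨a1, a2, -, -⟩ := hx z hz
      have hw : 0 < 1 - z ^ 2 := a1.trans_le a2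
      rw [div_le_iff₀ (by positivity)]
      have hBz : 0 ≤ B z := nonneg_of_mul_nonneg_right ((sq_nonneg _).trans (hH z hz))
        (by positivity)
      refine (hH z hz).trans ?_
      rw [mul_comm]
      gcongr
  have h2 : Tendsto (fun z => (1 - z ^ 2) ^ (n + 1) * ‖F z‖ ^ 2) (𝓝[>] (-1)) (𝓝 0) := by
    obtain ⟨z₁, hz₁, hB1⟩ : ∃ z₁ ∈ Ioo (-1 : ℝ) 0, ∀ z ∈ Ioc (-1 : ℝ) z₁, B z ≤ 1 := by
      have := hB.eventually (eventually_le_nhds (zero_lt_one (α := ℝ)))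
      obtain ⟨u, hu, hsub⟩ := mem_nhdsGT_iff_exists_Ioc_subset.1 this
      refine ⟨min u (-1 / 2), ⟨lt_min hu (by norm_num), (min_le_right _ _).trans_lt (by norm_num)⟩,
        fun z hz => hsub ⟨hz.1, hz.2.trans (min_le_left _ _)⟩⟩
    -- The hypothesis gives |F'| ≤ (1+z)^(-n/2-1) near the pole. Any β strictly between n/2 and
    -- (n+1)/2 would do: β > n/2 avoids a logarithm when n = 0, and β < (n+1)/2 makes w^(n+1)
    -- (1+z)^(-2β) tend to 0.
    set β : ℝ := n / 2 + 1 / 4 with hβ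
    have hβ0 : 0 < β := by positivity
    have hderiv : ∀ z ∈ Ioc (-1 : ℝ) z₁,
        ‖H z / (((1 - z ^ 2) ^ (n + 2) : ℝ) : ℂ)‖ ≤ (1 + z) ^ (-β - 1) := by
      intro z hz
      have hz' : z ∈ Ioo (-1 : ℝ) 0 := ⟨hz.1, hz.2.trans_lt hz₁.2⟩
      obtain ⟨a1, a2, a3, a4⟩ := hx z hz'
      have hw : 0 < 1 - z ^ 2 := a1.trans_le a2
      have e1 : ‖H z‖ ≤ (1 + z) ^ (((n : ℝ) + 2) / 2) := by
        refine (pow_le_pow_iff_left₀ (norm_nonneg _) (by positivity) two_ne_zero).1 ?_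
        rw [← rpow_mul_natCast a1.le, show ((n : ℝ) + 2) / 2 * ((2 : ℕ) : ℝ) = ((n + 2 : ℕ) : ℝ) by
          push_cast; ring, rpow_natCast]
        exact (hH z hz').trans (mul_le_of_le_one_right (by positivity) (hB1 z hz))
      rw [norm_div, Complex.norm_of_nonneg (by positivity), div_le_iff₀ (by positivity)]
      calc ‖H z‖ ≤ (1 + z) ^ (((n : ℝ) + 2) / 2) := e1
        _ ≤ (1 + z) ^ ((-β - 1) + ((n + 2 : ℕ) : ℝ)) := by
          refine rpow_le_rpow_of_exponent_ge a1 (a2.trans a4) ?_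
          rw [hβ]
          push_cast
          linarith
        _ = (1 + z) ^ (-β - 1) * (1 + z) ^ (n + 2) := by
          rw [rpow_add a1, rpow_natCast]
        _ ≤ (1 + z) ^ (-β - 1) * (1 - z ^ 2) ^ (n + 2) := by gcongr
    have hgrow : ∀ z ∈ Ioo (-1 : ℝ) z₁, ‖F z‖ ≤ (‖F z₁‖ + 1 / β) * (1 + z) ^ (-β) := by
      intro z hz
      have hsub : ∀ t ∈ Icc z z₁, t ∈ Ioc (-1 : ℝ) z₁ := fun t ht => ⟨hz.1.trans_le ht.1, ht.2⟩
      have hsub' : ∀ t ∈ Icc z z₁, t ∈ Ioo (-1 : ℝ) 1 := fun t ht =>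
        ⟨hz.1.trans_le ht.1, by linarith [ht.2, hz₁.2]⟩
      have hb : ∀ t ∈ Icc z z₁, HasDerivAt
          (fun t : ℝ => ((1 + z) ^ (-β) - (1 + t) ^ (-β)) / β) ((1 + t) ^ (-β - 1)) t := by
        intro t ht
        have ht1 : 1 + t ≠ 0 := by linarith [(hsub t ht).1]
        refine ((((hasDerivAt_id t).const_add 1).rpow_const (p := -β) (Or.inl ht1)).const_sub
          ((1 + z) ^ (-β)) |>.div_const β).congr_deriv ?_
        simp only [id]
        field_simp
      have := image_norm_le_of_norm_deriv_right_le_deriv_boundary'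
        (f := fun t => F t - F z) (f' := fun t => H t / (((1 - t ^ 2) ^ (n + 2) : ℝ) : ℂ))
        (a := z) (b := z₁) (fun t ht => ((hF t (hsub' t ht)).sub_const _).continuousAt.continuousWithinAt)
        (fun t ht => ((hF t (hsub' t ⟨ht.1, ht.2.le⟩)).sub_const _).hasDerivWithinAt)
        (B := fun t : ℝ => ((1 + z) ^ (-β) - (1 + t) ^ (-β)) / β)
        (B' := fun t : ℝ => (1 + t) ^ (-β - 1)) (by simp)
        (fun t ht => (hb t ht).continuousAt.continuousWithinAt)
        (fun t ht => (hb t ⟨ht.1, ht.2.le⟩).hasDerivWithinAt)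
        (fun t ht => hderiv t (hsub t ⟨ht.1, ht.2.le⟩)) (right_mem_Icc.2 hz.2.le)
      have hx0 : 0 < 1 + z := by linarith [hz.1]
      have hx1 : 1 + z ≤ 1 := by linarith [hz.2, hz₁.2]
      have hx2 : 0 < 1 + z₁ := by linarith [hz₁.1]
      have hone : 1 ≤ (1 + z) ^ (-β) := one_le_rpow_of_pos_of_le_one_of_nonpos hx0 hx1 (by linarith)
      have hp : 0 ≤ (1 + z₁) ^ (-β) := by positivity
      calc ‖F z‖ = ‖F z₁ - (F z₁ - F z)‖ := by rw [sub_sub_cancel]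
        _ ≤ ‖F z₁‖ + ((1 + z) ^ (-β) - (1 + z₁) ^ (-β)) / β :=
          (norm_sub_le _ _).trans (by gcongr)
        _ ≤ ‖F z₁‖ * (1 + z) ^ (-β) + (1 + z) ^ (-β) / β := by
          gcongr
          · exact le_mul_of_one_le_right (norm_nonneg _) hone
          · linarith
        _ = _ := by ring
    set D := ‖F z₁‖ + 1 / β with hD
    have hlim : Tendsto (fun z : ℝ => 2 ^ (n + 1) * D ^ 2 * (1 + z) ^ (1 / 2 : ℝ)) (𝓝[>] (-1))
        (𝓝 0) := by
      have : Continuous fun z : ℝ => 2 ^ (n + 1) * D ^ 2 * (1 + z) ^ (1 / 2 : ℝ) :=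
        continuous_const.mul ((continuous_const.add continuous_id).rpow_const
          fun _ => Or.inr (by norm_num))
      have h := this.tendsto (-1)
      simp only [add_neg_cancel, ne_eq, one_div, inv_eq_zero, OfNat.ofNat_ne_zero,
        not_false_eq_true, zero_rpow, mul_zero] at h
      simpa using h.mono_left nhdsWithin_le_nhds
    refine squeeze_zero' ?_ ?_ hlim
    · filter_upwards [eventually_mem_nhdsGT] with z hz
      have := one_sub_sq_pos hz
      positivity
    · filter_upwards [hneg, Ioo_mem_nhdsGT hz₁.1] with z hz hz'
      obtain ⟨a1, a2, a3, a4⟩ := hx z hz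
      have hw : 0 < 1 - z ^ 2 := a1.trans_le a2
      calc (1 - z ^ 2) ^ (n + 1) * ‖F z‖ ^ 2
          ≤ (2 * (1 + z)) ^ (n + 1) * (D * (1 + z) ^ (-β)) ^ 2 := by
            gcongr
            exact hgrow z hz'
        _ = 2 ^ (n + 1) * D ^ 2 * ((1 + z) ^ ((n + 1 : ℕ) : ℝ) * (1 + z) ^ ((-β) * (2 : ℕ))) := by
            rw [rpow_mul_natCast a1.le, rpow_natCast, mul_pow 2 (1 + z)]
            ring
        _ = 2 ^ (n + 1) * D ^ 2 * (1 + z) ^ (1 / 2 : ℝ) := by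
            rw [← rpow_add a1, hβ]
            congr 2
            push_cast
            ring
  refine ⟨h1, h2, ?_⟩
  have := h1.add h2
  rw [add_zero] at this
  refine squeeze_zero' (.of_forall fun z => by positivity) ?_ this
  filter_upwards [hneg] with z hz
  obtain ⟨a1, a2, a3, a4⟩ := hx z hz
  have hw : 0 < 1 - z ^ 2 := a1.trans_le a2
  have e1 : (1 - z ^ 2) ^ (n + 2) * ‖F z‖ ^ 2 ≤ (1 - z ^ 2) ^ (n + 1) * ‖F z‖ ^ 2 := by
    gcongr ?_ * _
    exact pow_le_pow_of_le_one hw.le a4 (by omega)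
  have hk : 0 < (1 - z ^ 2) ^ (n + 2) := by positivity
  refine le_trans ?_ (add_le_add_right e1 _)
  rw [div_add' _ _ _ hk.ne', le_div_iff₀ hk]
  -- The inequality of arithmetic and geometric means, |H||F| ≤ |H|²/w^(n+2) + w^(n+2)|F|².
  nlinarith [sq_nonneg (‖H z‖ - (1 - z ^ 2) ^ (n + 2) * ‖F z‖),
    mul_nonneg hk.le (mul_nonneg (norm_nonneg (H z)) (norm_nonneg (F z)))]

namespace WeakMode

variable {n : ℕ} {U V : ℝ → ℂ}

lemma ae_ofReal_ne (μ : ℂ) : ∀ᵐ z : ℝ, (z : ℂ) ≠ μ := by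
  have : (volume : Measure ℝ) {z : ℝ | (z : ℂ) = μ} = 0 := by
    refine Set.Subsingleton.measure_zero (fun a ha b hb => ?_) _
    exact Complex.ofReal_injective (Eq.trans ha (Eq.symm hb))
  exact measure_eq_zero_iff_ae_notMem.1 this

lemma norm_source_sq (n : ℕ) (U V : ℝ → ℂ) {t : ℝ} (ht : t ∈ Ioo (-1 : ℝ) 1) :
    ‖source n U V t‖ ^ 2 = (1 - t ^ 2) ^ (n + 1) * ‖shifted n U V t‖ ^ 2 := by
  rw [source, norm_mul, Complex.norm_of_nonneg (by positivity), mul_pow, sq (√(1 - t ^ 2) ^ (n + 1)),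
    sqrt_pow_mul_self _ ht]

lemma memLp_source (S : WeakMode n U V) :
    MemLp (source n U V) 2 (volume.restrict (Ioo (-1) 1)) := by
  refine S.memLp_shifted.mono S.integrableOn_source.aestronglyMeasurable ?_
  filter_upwards [ae_restrict_mem measurableSet_Ioo] with t ht
  refine (pow_le_pow_iff_left₀ (norm_nonneg _) (norm_nonneg _) two_ne_zero).1 ?_
  rw [norm_source_sq _ _ _ ht]
  exact mul_le_of_le_one_left (sq_nonneg _)
    (pow_le_one₀ (one_sub_sq_pos ht).le (by linarith [sq_nonneg t]))

/-- Cauchy's inequality for the flux through a spherical cap. -/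
lemma norm_integral_source_sq_le (S : WeakMode n U V) {a b x : ℝ} (hab : a ≤ b)
    (hsub : Ioo a b ⊆ Ioo (-1) 1) (hx : ∀ t ∈ Ioo a b, 1 - t ^ 2 ≤ 2 * x) :
    ‖∫ t in a..b, source n U V t‖ ^ 2 ≤
      (b - a) * ((2 * x) ^ (n + 1) * ∫ t in Ioo a b, ‖shifted n U V t‖ ^ 2) := by
  have hA : Integrable (fun t => ‖shifted n U V t‖ ^ 2) (volume.restrict (Ioo a b)) :=
    (S.memLp_shifted.integrable_norm_pow (by norm_num)).mono_measure
      (Measure.restrict_mono hsub le_rfl)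
  have hG := S.memLp_source.mono_measure (Measure.restrict_mono hsub le_rfl)
  rw [intervalIntegral.integral_of_le hab, integral_Ioc_eq_integral_Ioo, ← integral_const_mul]
  refine (norm_integral_sq_le hG).trans ?_
  have hv : (volume.restrict (Ioo a b)).real univ = b - a := by
    simp [measureReal_def, ENNReal.toReal_ofReal, hab]
  rw [hv]
  refine mul_le_mul_of_nonneg_left ?_ (sub_nonneg.2 hab)
  refine setIntegral_mono_on (hG.integrable_norm_pow (by norm_num)) (hA.const_mul _)
    measurableSet_Ioo fun t ht => ?_
  rw [norm_source_sq _ _ _ (hsub ht)]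
  have := one_sub_sq_pos (hsub ht)
  gcongr
  exact hx t ht

lemma intervalIntegrable_shifted_sq (S : WeakMode n U V) :
    IntervalIntegrable (fun t => ‖shifted n U V t‖ ^ 2) volume (-1) 1 :=
  (intervalIntegrable_iff_integrableOn_Ioo_of_le (by norm_num)).2
    (S.memLp_shifted.integrable_norm_pow (by norm_num))

lemma tendsto_integral_shifted_left (S : WeakMode n U V) :
    Tendsto (fun z => ∫ t in Ioo (-1) z, ‖shifted n U V t‖ ^ 2) (𝓝[>] (-1)) (𝓝 0) := by
  have := intervalIntegral.continuousOn_primitive_interval' S.intervalIntegrable_shifted_sq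
    (a := -1) (by simp) (-1) (by simp)
  rw [uIcc_of_le (by norm_num)] at this
  have h := (this.mono_of_mem_nhdsWithin (Icc_mem_nhdsGT (by norm_num))).tendsto
  rw [intervalIntegral.integral_same] at h
  refine h.congr' ?_
  filter_upwards [self_mem_nhdsWithin] with z (hz : -1 < z)
  rw [intervalIntegral.integral_of_le hz.le, integral_Ioc_eq_integral_Ioo]

lemma tendsto_integral_shifted_right (S : WeakMode n U V) :
    Tendsto (fun z => ∫ t in Ioo z 1, ‖shifted n U V t‖ ^ 2) (𝓝[<] 1) (𝓝 0) := by
  have := intervalIntegral.continuousOn_primitive_interval' S.intervalIntegrable_shifted_sq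
    (a := 1) (by simp) 1 (by simp)
  rw [uIcc_of_le (by norm_num)] at this
  have h := (this.mono_of_mem_nhdsWithin (Icc_mem_nhdsLT (by norm_num))).tendsto.neg
  rw [intervalIntegral.integral_same, neg_zero] at h
  refine h.congr' ?_
  filter_upwards [self_mem_nhdsWithin] with z (hz : z < 1)
  rw [← intervalIntegral.integral_symm, intervalIntegral.integral_of_le hz.le,
    integral_Ioc_eq_integral_Ioo]

/-- The flux, the profile and the equation make up a classical solution. -/
lemma modeODE (S : WeakMode n U V) {μ : ℂ} (hμ : μ ≠ 0)
    (heq : ∀ᵐ z, z ∈ Ioo (-1 : ℝ) 1 → (z : ℂ) * (U z + 6 * V z) = μ * U z) {c : ℂ}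
    (hc : ∀ᵐ z, z ∈ Ioo (-1 : ℝ) 1 →
      V z = ((√(1 - z ^ 2) ^ (n + 1) : ℝ) : ℂ) * (profile n U V z + c)) :
    ModeODE n μ (fun z => profile n U V z + c) (flux n U V) := by
  set F : ℝ → ℂ := fun z => profile n U V z + c with hF
  have hFd : ∀ z ∈ Ioo (-1 : ℝ) 1,
      HasDerivAt F (flux n U V z / (((1 - z ^ 2) ^ (n + 2) : ℝ) : ℂ)) z := fun z hz =>
    (S.hasDerivAt_profile hz).add_const c
  have hFc : ContinuousOn F (Ioo (-1) 1) := fun z hz =>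
    (hFd z hz).continuousAt.continuousWithinAt
  have hne := ae_ofReal_ne μ
  have hU : ∀ᵐ z, z ∈ Ioo (-1 : ℝ) 1 → U z = -(6 * z *
      ((√(1 - z ^ 2) ^ (n + 1) : ℝ) : ℂ) * F z) / (z - μ) := by
    filter_upwards [heq, hc, hne] with z h1 h2 h3 hz
    have hd : (z : ℂ) - μ ≠ 0 := sub_ne_zero.2 h3
    have h1' := h1 hz
    rw [eq_div_iff hd, hF]
    have h2' := h2 hz
    rw [mul_assoc, ← h2']
    linear_combination h1'
  have hsrc : ∀ᵐ z, z ∈ Ioo (-1 : ℝ) 1 → source n U V z = (((1 - z ^ 2) ^ (n + 1) : ℝ) : ℂ) *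
      ((((n + 1) * (n + 2) : ℝ) : ℂ) - 6 * z / (z - μ)) * F z := by
    filter_upwards [hU, hc, hne] with z h1 h2 h3 hz
    have hd : (z : ℂ) - μ ≠ 0 := sub_ne_zero.2 h3
    rw [source, shifted, h1 hz, h2 hz, ← sqrt_pow_mul_self _ hz]
    push_cast
    field_simp
    ring
  have hleft := tendsto_at_pole hFd (B := fun z => 2 ^ (n + 1) *
    ∫ t in Ioo (-1) z, ‖shifted n U V t‖ ^ 2) (fun z hz => by
      refine (S.norm_integral_source_sq_le (x := 1 + z) hz.1.le
        (Ioo_subset_Ioo_right (by linarith [hz.2])) fun t ht => ?_).trans (le_of_eq ?_)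
      · nlinarith [ht.1, ht.2, hz.1, hz.2]
      · rw [mul_pow]; ring) (by simpa using S.tendsto_integral_shifted_left.const_mul (2 ^ (n + 1)))
  -- The pole z = 1 is handled by reflection; as the total integral of the source is zero, the
  -- reflected flux is again an integral over a small cap.
  have hright := tendsto_at_pole (n := n) (F := fun z => F (-z)) (H := fun z => -flux n U V (-z))
    (B := fun z => 2 ^ (n + 1) * ∫ t in Ioo (-z) 1, ‖shifted n U V t‖ ^ 2) (fun z hz => by
      refine ((hFd (-z) ⟨neg_lt_neg hz.2, by linarith [hz.1]⟩).scomp z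
        (hasDerivAt_neg z)).congr_deriv ?_
      simp only [neg_smul, one_smul, neg_sq]
      ring) (fun z hz => by
      have e : -flux n U V (-z) = ∫ t in (-z)..1, source n U V t := by
        have hz1 : -z ∈ uIcc (-1 : ℝ) 1 := by
          rw [uIcc_of_le (by norm_num)]
          exact ⟨by linarith [hz.2], by linarith [hz.1]⟩
        rw [flux, neg_eq_iff_add_eq_zero, intervalIntegral.integral_add_adjacent_intervals
          (S.intervalIntegrable_source.mono_set (uIcc_subset_uIcc_left hz1))
          (S.intervalIntegrable_source.mono_set (uIcc_subset_uIcc_right hz1)), S.integral_source]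
      rw [e]
      refine (S.norm_integral_source_sq_le (x := 1 + z) (by linarith [hz.1])
        (Ioo_subset_Ioo_left (by linarith [hz.2])) fun t ht => ?_).trans (le_of_eq ?_)
      · nlinarith [ht.1, ht.2, hz.1, hz.2]
      · rw [mul_pow]; ring) (by
      simpa using (S.tendsto_integral_shifted_right.comp
        (RealModeODE.tendsto_neg_nhdsGT 1)).const_mul (2 ^ (n + 1)))
  refine ⟨hFd, ?_, S.continuousOn_flux_Icc.mono Ioo_subset_Icc_self, hleft.2.2, ?_, hleft.2.1, ?_,
    hleft.1, ?_, ?_⟩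
  · intro z hz hzμ
    -- The flux is an integral, so its density may be replaced by this almost everywhere equal
    -- function, which is continuous off μ.
    set g : ℝ → ℂ := fun z => (((1 - z ^ 2) ^ (n + 1) : ℝ) : ℂ) *
      ((((n + 1) * (n + 2) : ℝ) : ℂ) - 6 * z / (z - μ)) * F z with hg
    have hopen : IsOpen (Ioo (-1 : ℝ) 1 ∩ {z : ℝ | (z : ℂ) ≠ μ}) :=
      isOpen_Ioo.inter (isOpen_ne.preimage Complex.continuous_ofReal)
    have hgc : ContinuousOn g (Ioo (-1 : ℝ) 1 ∩ {z : ℝ | (z : ℂ) ≠ μ}) := by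
      refine (ContinuousOn.mul ?_ ?_).mul (hFc.mono inter_subset_left)
      · exact (Complex.continuous_ofReal.comp (by fun_prop)).continuousOn
      · refine continuousOn_const.sub (ContinuousOn.div ?_ ?_ fun t ht => sub_ne_zero.2 ht.2)
        · exact (continuous_const.mul Complex.continuous_ofReal).continuousOn
        · exact (Complex.continuous_ofReal.sub continuous_const).continuousOn
    have hz' : z ∈ Ioo (-1 : ℝ) 1 ∩ {z : ℝ | (z : ℂ) ≠ μ} := ⟨hz, hzμ⟩
    have hae : ∀ᵐ t, t ∈ uIoc (-1) (1 : ℝ) → source n U V t = g t := by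
      filter_upwards [hsrc, measure_eq_zero_iff_ae_notMem.1 (measure_singleton (1 : ℝ))]
        with t ht h1 ht'
      rw [uIoc_of_le (by norm_num)] at ht'
      exact ht ⟨ht'.1, lt_of_le_of_ne ht'.2 h1⟩
    have hgi : IntervalIntegrable g volume (-1) 1 := by
      refine S.intervalIntegrable_source.congr_ae ?_
      rwa [Filter.EventuallyEq, ae_restrict_iff' measurableSet_uIoc]
    have hzu : ∀ t ∈ Ioo (-1 : ℝ) 1, t ∈ uIcc (-1 : ℝ) 1 := fun t ht => by
      rw [uIcc_of_le (by norm_num)]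
      exact Ioo_subset_Icc_self ht
    have key := intervalIntegral.integral_hasDerivAt_right
      (hgi.mono_set (uIcc_subset_uIcc_left (hzu z hz)))
      (hgc.stronglyMeasurableAtFilter hopen z hz') (hgc.continuousAt (hopen.mem_nhds hz'))
    refine key.congr_of_eventuallyEq ?_
    filter_upwards [isOpen_Ioo.mem_nhds hz] with t ht
    refine intervalIntegral.integral_congr_ae ?_
    filter_upwards [hae] with x hx hx'
    refine hx ?_
    rw [uIoc_of_le ht.1.le] at hx'
    rw [uIoc_of_le (by norm_num)]
    exact ⟨hx'.1, hx'.2.trans ht.2.le⟩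
  · exact (hright.2.2.comp (RealModeODE.tendsto_neg_nhdsLT 1)).congr fun z => by simp
  · exact (hright.2.1.comp (RealModeODE.tendsto_neg_nhdsLT 1)).congr fun z => by simp
  · exact (hright.1.comp (RealModeODE.tendsto_neg_nhdsLT 1)).congr fun z => by simp
  · intro x hx hxμ
    -- If F(μ) ≠ 0, then |U| is bounded below by a multiple of 1/|z - μ| near μ, which is not
    -- integrable. The factor z in the numerator does no harm since μ ≠ 0.
    by_contra hFx
    have hx0 : x ≠ 0 := fun h => hμ (by rw [← hxμ, h]; simp)
    set g : ℝ → ℂ := fun z => -(6 * z * ((√(1 - z ^ 2) ^ (n + 1) : ℝ) : ℂ) * F z) / (z - μ) with hg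
    have hgi : IntervalIntegrable g volume (-1) 1 := by
      rw [intervalIntegrable_iff_integrableOn_Ioo_of_le (by norm_num)]
      refine (integrableOn_of_memLp S.memU).congr ?_
      rwa [Filter.EventuallyEq, ae_restrict_iff' measurableSet_Ioo]
    refine not_intervalIntegrable_of_sub_inv_isBigO_punctured (f := g) (c := x) ?_ (by norm_num)
      (by rw [uIcc_of_le (by norm_num)]; exact Ioo_subset_Icc_self hx) hgi
    set k : ℝ → ℂ := fun z => 6 * z * ((√(1 - z ^ 2) ^ (n + 1) : ℝ) : ℂ) * F z with hk
    have hkc : ContinuousAt k x := by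
      refine ContinuousAt.mul (Continuous.continuousAt ?_) (hFd x hx).continuousAt
      exact (continuous_const.mul Complex.continuous_ofReal).mul
        (Complex.continuous_ofReal.comp (by fun_prop))
    have hkx : k x ≠ 0 := by
      have h1 : ((√(1 - x ^ 2) ^ (n + 1) : ℝ) : ℂ) ≠ 0 := by
        exact_mod_cast (pow_pos (Real.sqrt_pos.2 (one_sub_sq_pos hx)) _).ne'
      have h2 : (x : ℂ) ≠ 0 := by exact_mod_cast hx0
      exact mul_ne_zero (mul_ne_zero (mul_ne_zero (by norm_num) h2) h1) hFx
    have hev := hkc.norm.eventually (lt_mem_nhds (half_lt_self (norm_pos_iff.2 hkx)))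
    refine Asymptotics.IsBigO.of_bound (2 / ‖k x‖) ?_
    filter_upwards [nhdsWithin_le_nhds hev] with z hz
    have e : ‖g z‖ = ‖k z‖ * ‖(z - x)⁻¹‖ := by
      rw [hg, ← hxμ]
      simp only [norm_div, norm_neg]
      rw [norm_inv, div_eq_mul_inv, ← Complex.ofReal_sub, Complex.norm_real]
    rw [e, ← mul_assoc]
    refine le_mul_of_one_le_left (norm_nonneg _) ?_
    have := norm_pos_iff.2 hkx
    rw [div_mul_eq_mul_div, le_div_iff₀ this]
    linarith

/-- An eigenfunction of a nonzero longitudinal mode vanishes. -/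
theorem ae_eq_zero (S : WeakMode n U V) {μ : ℂ} (hμ : μ ≠ 0)
    (heq : ∀ᵐ z, z ∈ Ioo (-1 : ℝ) 1 → (z : ℂ) * (U z + 6 * V z) = μ * U z) :
    ∀ᵐ z, z ∈ Ioo (-1 : ℝ) 1 → U z = 0 := by
  obtain ⟨c, hc⟩ := S.ae_eq_profile
  have h0 := (S.modeODE hμ heq hc).eq_zero hμ
  have hne := ae_ofReal_ne μ
  filter_upwards [heq, hc, hne] with z h1 h2 h3 hz
  have hV : V z = 0 := by rw [h2 hz, h0 z hz, mul_zero]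
  have h1' := h1 hz
  rw [hV, mul_zero, add_zero, ← sub_eq_zero, ← sub_mul] at h1'
  exact (mul_eq_zero.1 h1').resolve_left (sub_ne_zero.2 h3)

end WeakMode

/-! ### Surface measure in height and longitude -/

section Archimedes

open scoped ENNReal Pointwise

/-- The point of `S²` with height `z ∈ [-1, 1]` and longitude `φ`. -/
def spherePoint (q : ℝ × ℝ) : S2 :=
  ⟨!₂[sin (arccos q.1) * cos q.2, sin (arccos q.1) * sin q.2, cos (arccos q.1)], by
    have h1 := Real.sin_sq_add_cos_sq q.2
    have h2 := Real.sin_sq_add_cos_sq (arccos q.1)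
    rw [mem_sphere_zero_iff_norm, EuclideanSpace.norm_eq, Fin.sum_univ_three, Real.sqrt_eq_one]
    simp only [Real.norm_eq_abs, sq_abs, Matrix.cons_val]
    linear_combination h2 + sin (arccos q.1) ^ 2 * h1⟩

lemma continuous_toLp_vec {α : Type*} [TopologicalSpace α] {a b c : α → ℝ} (ha : Continuous a)
    (hb : Continuous b) (hc : Continuous c) : Continuous fun x => (!₂[a x, b x, c x] : E3) := by
  refine (PiLp.continuous_toLp 2 _).comp (continuous_pi fun i => ?_)
  fin_cases i <;> simpa

lemma continuous_spherePoint : Continuous spherePoint := by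
  refine Continuous.subtype_mk (continuous_toLp_vec ?_ ?_ ?_) _ <;> fun_prop

lemma measurePreserving_cylinder :
    MeasurePreserving (fun y : E3 => (y 2, y 0, y 1)) volume (volume : Measure (ℝ × ℝ × ℝ)) := by
  have h1 := PiLp.volume_preserving_ofLp (Fin 3)
  have h2 := volume_preserving_piFinSuccAbove (fun _ : Fin 3 => ℝ) 2
  have h3 := (MeasurePreserving.id (volume : Measure ℝ)).prod (volume_preserving_finTwoArrow ℝ)
  exact (h3.comp h2).comp h1

/-- Integration in cylindrical coordinates, with the longitude on the outside. -/
lemma lintegral_cylinder {f : ℝ × ℝ × ℝ → ℝ≥0∞} (hf : Measurable f) :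
    ∫⁻ y, f y = ∫⁻ φ in Ioo (-π) π, ∫⁻ h, ∫⁻ ρ in Ioi (0 : ℝ),
      ENNReal.ofReal ρ * f (h, ρ * cos φ, ρ * sin φ) := by
  have hm : Measurable fun p : ℝ × ℝ × ℝ =>
      ENNReal.ofReal p.2.1 * f (p.1, p.2.1 * cos p.2.2, p.2.1 * sin p.2.2) := by
    refine (by fun_prop : Measurable fun p : ℝ × ℝ × ℝ => ENNReal.ofReal p.2.1).mul (hf.comp ?_)
    fun_prop
  rw [Measure.volume_eq_prod, lintegral_prod _ hf.aemeasurable]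
  have h1 : ∀ h : ℝ, ∫⁻ p : ℝ × ℝ, f (h, p) = ∫⁻ φ in Ioo (-π) π, ∫⁻ ρ in Ioi (0 : ℝ),
      ENNReal.ofReal ρ * f (h, ρ * cos φ, ρ * sin φ) := by
    intro h
    rw [← lintegral_comp_polarCoord_symm, polarCoord_target, Measure.volume_eq_prod,
      ← Measure.prod_restrict, lintegral_prod_symm]
    · rfl
    · exact (hm.comp (measurable_prodMk_left (x := h))).aemeasurable
  simp only [h1]
  rw [lintegral_lintegral_swap]
  refine (Measurable.lintegral_prod_right' (f := fun p : (ℝ × ℝ) × ℝ =>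
    ENNReal.ofReal p.2 * f (p.1.1, p.2 * cos p.1.2, p.2 * sin p.1.2)) ?_).aemeasurable
  exact hm.comp (by fun_prop : Measurable fun p : (ℝ × ℝ) × ℝ => (p.1.1, p.2, p.1.2))

lemma lintegral_sin_mul_comp_cos (g : ℝ → ℝ≥0∞) :
    ∫⁻ θ in Ioo 0 π, ENNReal.ofReal (sin θ) * g (cos θ) = ∫⁻ z in Ioo (-1 : ℝ) 1, g z := by
  have himg : cos '' Ioo 0 π = Ioo (-1) 1 := by
    ext z
    constructor
    · rintro ⟨θ, hθ, rfl⟩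
      constructor
      · rw [← cos_pi]
        exact cos_lt_cos_of_nonneg_of_le_pi hθ.1.le le_rfl hθ.2
      · rw [← cos_zero]
        exact cos_lt_cos_of_nonneg_of_le_pi le_rfl hθ.2.le hθ.1
    · intro hz
      refine ⟨arccos z, ⟨arccos_pos.2 hz.2, ?_⟩, cos_arccos hz.1.le hz.2.le⟩
      refine lt_of_le_of_ne (arccos_le_pi z) fun h => ?_
      rw [arccos_eq_pi] at h
      exact absurd hz.1 (not_lt.2 h)
  rw [← himg, lintegral_image_eq_lintegral_abs_deriv_mul measurableSet_Ioo
    (fun θ _ => (hasDerivAt_cos θ).hasDerivWithinAt)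
    (injOn_cos.mono Ioo_subset_Icc_self)]
  refine setLIntegral_congr_fun measurableSet_Ioo fun θ hθ => ?_
  simp only [abs_neg, abs_of_pos (sin_pos_of_mem_Ioo hθ)]

lemma lintegral_sq_Ioo : ∫⁻ r in Ioo (0 : ℝ) 1, ENNReal.ofReal (r ^ 2) = ENNReal.ofReal (1 / 3) := by
  rw [← ofReal_integral_eq_lintegral_ofReal]
  · rw [← integral_Ioc_eq_integral_Ioo, ← intervalIntegral.integral_of_le zero_le_one, integral_pow]
    norm_num
  · exact (continuous_pow 2).integrableOn_Icc.mono_set Ioo_subset_Icc_self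
  · exact .of_forall fun r => sq_nonneg r

/-- **Archimedes**: in the coordinates height and longitude the surface measure of the sphere is
Lebesgue measure. -/
theorem sigma_eq_map :
    sigma = ((volume : Measure (ℝ × ℝ)).restrict (Ioo (-1) 1 ×ˢ Ioo (-π) π)).map spherePoint := by
  ext s hs
  obtain ⟨s', hs', rfl⟩ := hs
  -- The cone over the given set, inside the unit ball and without its apex; the surface measure is
  -- three times its volume.
  set T : Set E3 := {y | ‖y‖ ∈ Ioo (0 : ℝ) 1 ∧ ‖y‖⁻¹ • y ∈ s'} with hT
  have hTm : MeasurableSet T := by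
    refine (measurable_norm measurableSet_Ioo).inter ?_
    exact (by fun_prop : Measurable fun y : E3 => ‖y‖⁻¹ • y) hs'
  have hTeq : Ioo (0 : ℝ) 1 • ((↑) '' ((↑) ⁻¹' s' : Set S2) : Set E3) = T := by
    ext y
    simp only [Set.mem_smul, hT, mem_ofPred_eq]
    constructor
    · rintro ⟨r, hr, -, ⟨x, hx, rfl⟩, rfl⟩
      have hx1 : ‖(x : E3)‖ = 1 := by simp
      have hr0 := hr.1
      rw [norm_smul, hx1, mul_one, Real.norm_of_nonneg hr0.le, smul_smul,
        inv_mul_cancel₀ hr0.ne', one_smul]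
      exact ⟨hr, hx⟩
    · rintro ⟨h1, h2⟩
      have h0 := h1.1.ne'
      refine ⟨‖y‖, h1, ‖y‖⁻¹ • y, ⟨⟨‖y‖⁻¹ • y, ?_⟩, h2, rfl⟩, ?_⟩
      · rw [mem_sphere_zero_iff_norm, norm_smul, norm_inv, norm_norm, inv_mul_cancel₀ h0]
      · beta_reduce
        rw [smul_smul, mul_inv_cancel₀ h0, one_smul]
  set T' : Set (ℝ × ℝ × ℝ) := (fun p => (!₂[p.2.1, p.2.2, p.1] : E3)) ⁻¹' T with hT'
  have hT'm : MeasurableSet T' :=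
    (continuous_toLp_vec (by fun_prop) (by fun_prop) (by fun_prop)).measurable hTm
  have hvol : volume T = volume T' := by
    rw [← measurePreserving_cylinder.measure_preimage hT'm.nullMeasurableSet]
    congr 1
    ext y
    have : (!₂[y 0, y 1, y 2] : E3) = y := by
      ext i
      fin_cases i <;> rfl
    simp [hT', this]
  have hpm : MeasurableSet (spherePoint ⁻¹' ((↑) ⁻¹' s' : Set S2)) :=
    continuous_spherePoint.measurable (measurable_subtype_coe hs')
  have key : ∀ φ, ∫⁻ h, ∫⁻ ρ in Ioi (0 : ℝ),
      ENNReal.ofReal ρ * T'.indicator 1 (h, ρ * cos φ, ρ * sin φ) = ENNReal.ofReal (1 / 3) *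
        ∫⁻ z in Ioo (-1 : ℝ) 1, (spherePoint ⁻¹' ((↑) ⁻¹' s' : Set S2)).indicator 1 (z, φ) := by
    intro φ
    have hm : Measurable fun p : ℝ × ℝ => (Ioi (0 : ℝ)).indicator (fun ρ =>
        ENNReal.ofReal ρ * T'.indicator 1 (p.1, ρ * cos φ, ρ * sin φ)) p.2 := by
      have : (fun p : ℝ × ℝ => (Ioi (0 : ℝ)).indicator (fun ρ =>
          ENNReal.ofReal ρ * T'.indicator 1 (p.1, ρ * cos φ, ρ * sin φ)) p.2) =
          ({p : ℝ × ℝ | 0 < p.2}).indicator (fun p =>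
            ENNReal.ofReal p.2 * T'.indicator 1 (p.1, p.2 * cos φ, p.2 * sin φ)) := by
        ext p
        simp [indicator_apply]
      rw [this]
      refine Measurable.indicator ?_ (measurableSet_lt measurable_const measurable_snd)
      refine Measurable.mul (by fun_prop) ((measurable_one.indicator hT'm).comp ?_)
      fun_prop
    have e1 : ∫⁻ h, ∫⁻ ρ in Ioi (0 : ℝ),
        ENNReal.ofReal ρ * T'.indicator 1 (h, ρ * cos φ, ρ * sin φ) =
        ∫⁻ p : ℝ × ℝ, (Ioi (0 : ℝ)).indicator (fun ρ =>
        ENNReal.ofReal ρ * T'.indicator 1 (p.1, ρ * cos φ, ρ * sin φ)) p.2 := by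
      rw [Measure.volume_eq_prod, lintegral_prod _ hm.aemeasurable]
      simp only [lintegral_indicator measurableSet_Ioi]
    -- Polar coordinates h = r cos θ, ρ = r sin θ in the meridian plane: the Jacobian r and the
    -- weight ρ give r² sin θ. The integral in r is 1/3, cancelling the dimension 3, and z = cos θ
    -- removes sin θ.
    rw [e1, ← lintegral_comp_polarCoord_symm, ← lintegral_sin_mul_comp_cos
      (fun z => (spherePoint ⁻¹' ((↑) ⁻¹' s' : Set S2)).indicator 1 (z, φ)), ← lintegral_sq_Ioo,
      ← lintegral_indicator measurableSet_Ioo, ← lintegral_indicator measurableSet_Ioo]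
    rw [← lintegral_prod_mul]
    · rw [← lintegral_indicator (polarCoord.open_target.measurableSet)]
      refine lintegral_congr fun q => ?_
      obtain ⟨r, θ⟩ := q
      by_cases hq : (r, θ) ∈ polarCoord.target
      · rw [indicator_of_mem hq]
        rw [polarCoord_target] at hq
        have hr : 0 < r := hq.1
        simp only [polarCoord_symm_apply, smul_eq_mul]
        by_cases hθ : θ ∈ Ioo 0 π
        · have hs : 0 < sin θ := sin_pos_of_mem_Ioo hθ
          rw [indicator_of_mem hθ, indicator_of_mem (show r * sin θ ∈ Ioi 0 from mul_pos hr hs)]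
          have hpt : (!₂[r * sin θ * cos φ, r * sin θ * sin φ, r * cos θ] : E3) =
              r • (spherePoint (cos θ, φ) : E3) := by
            ext i
            fin_cases i <;> simp [spherePoint, arccos_cos hθ.1.le hθ.2.le, mul_assoc]
          have hnorm : ‖r • (spherePoint (cos θ, φ) : E3)‖ = r := by
            rw [norm_smul, Real.norm_of_nonneg hr.le, norm_eq_of_mem_sphere, mul_one]
          have hmem : (r * cos θ, r * sin θ * cos φ, r * sin θ * sin φ) ∈ T' ↔
              r ∈ Ioo (0 : ℝ) 1 ∧ (cos θ, φ) ∈ spherePoint ⁻¹' ((↑) ⁻¹' s' : Set S2) := by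
            rw [hT', mem_preimage, hpt, hT, mem_ofPred_eq, hnorm, smul_smul,
              inv_mul_cancel₀ hr.ne', one_smul]
            rfl
          by_cases h1 : r ∈ Ioo (0 : ℝ) 1
          · rw [indicator_of_mem h1]
            by_cases h2 : (cos θ, φ) ∈ spherePoint ⁻¹' ((↑) ⁻¹' s' : Set S2)
            · rw [indicator_of_mem h2, indicator_of_mem (hmem.2 ⟨h1, h2⟩)]
              simp only [Pi.one_apply, mul_one]
              rw [← ENNReal.ofReal_mul hr.le, ← ENNReal.ofReal_mul (sq_nonneg r)]
              ring_nf
            · rw [indicator_of_notMem h2, indicator_of_notMem fun h => h2 (hmem.1 h).2]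
              simp only [mul_zero]
          · rw [indicator_of_notMem h1, indicator_of_notMem fun h => h1 (hmem.1 h).1]
            simp only [mul_zero, zero_mul]
        · rw [indicator_of_notMem hθ, indicator_of_notMem, mul_zero, mul_zero]
          intro h
          have hs : 0 < sin θ := pos_of_mul_pos_right h hr.le
          refine hθ ⟨?_, hq.2.2⟩
          by_contra! h0
          exact absurd hs (not_lt.2 (sin_nonpos_of_nonpos_of_neg_pi_le h0 hq.2.1.le))
      · rw [indicator_of_notMem hq]
        rw [polarCoord_target, mem_prod, not_and_or] at hq
        rcases hq with h | h
        · rw [indicator_of_notMem (fun h' => h h'.1), zero_mul]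
        · rw [indicator_of_notMem (s := Ioo 0 π)
            (fun h' => h ⟨by linarith [h'.1, pi_pos], h'.2⟩), mul_zero]
    · exact ((by fun_prop : Measurable fun r : ℝ => ENNReal.ofReal (r ^ 2)).indicator
        measurableSet_Ioo).aemeasurable
    · refine (Measurable.indicator (Measurable.mul (by fun_prop) ?_)
        measurableSet_Ioo).aemeasurable
      exact (measurable_one.indicator hpm).comp (by fun_prop : Measurable fun θ => (cos θ, φ))
  have hfin : Module.finrank ℝ E3 = 3 := by simp
  rw [sigma, Measure.toSphere_apply' _ (measurable_subtype_coe hs'), hTeq, hvol,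
    ← lintegral_indicator_one hT'm, lintegral_cylinder (measurable_one.indicator hT'm), hfin]
  simp only [key]
  rw [lintegral_const_mul', Measure.map_apply continuous_spherePoint.measurable
    (measurable_subtype_coe hs'), ← lintegral_indicator_one hpm, Measure.volume_eq_prod,
    ← Measure.prod_restrict, lintegral_prod_symm, ← mul_assoc]
  · rw [show ((3 : ℕ) : ℝ≥0∞) * ENNReal.ofReal (1 / 3) = 1 by
      rw [← ENNReal.ofReal_natCast, ← ENNReal.ofReal_mul (by norm_num)]; norm_num, one_mul]
  · exact (measurable_one.indicator hpm).aemeasurable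
  · exact ENNReal.ofReal_ne_top

end Archimedes


/-! ### Test functions of a single mode and their Laplacian -/

/-- The function `(x₁ + ζ x₂)^k p(x₃)` on `S²`; for `ζ = ± i` it lies in the longitudinal
mode `± k`. -/
def modeTest (ζ : ℂ) (k : ℕ) (p : ℝ → ℝ) (x : S2) : ℂ :=
  (((x : E3) 0 : ℂ) + ζ * ((x : E3) 1 : ℂ)) ^ k * (p ((x : E3) 2) : ℂ)

lemma isSmooth_modeTest (ζ : ℂ) (k : ℕ) {p : ℝ → ℝ} (hp : ContDiff ℝ ∞ p) :
    IsSmooth (modeTest ζ k p) := by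
  have h : ContDiff ℝ ∞ fun y : E3 => ((y 0 : ℂ) + ζ * (y 1 : ℂ)) ^ k * (p (y 2) : ℂ) := by
    have hc : ∀ i, ContDiff ℝ ∞ fun y : E3 => y i := fun i => by fun_prop
    have ho : ContDiff ℝ ∞ (fun r : ℝ => (r : ℂ)) := Complex.ofRealCLM.contDiff
    exact (((ho.comp (hc 0)).add (contDiff_const.mul (ho.comp (hc 1)))).pow k).mul
      (ho.comp (hp.comp (hc 2)))
  have : Fact (Module.finrank ℝ E3 = 2 + 1) := ⟨finrank_euclideanSpace_fin⟩
  exact h.contMDiff.comp contMDiff_coe_sphere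

lemma modeTest_rot {ζ : ℂ} (hζ : ζ ^ 2 = -1) (k : ℕ) (p : ℝ → ℝ) (s : ℝ) (x : S2) :
    modeTest ζ k p (rot s x) = ((cos s : ℂ) + ζ * (sin s : ℂ)) ^ k * modeTest ζ k p x := by
  simp only [modeTest, rot, Matrix.cons_val, ← mul_assoc, ← mul_pow]
  congr 2
  push_cast
  linear_combination (-(Complex.sin s * ((x : E3) 1 : ℂ))) * hζ

lemma dPhi_modeTest {ζ : ℂ} (hζ : ζ ^ 2 = -1) (k : ℕ) (p : ℝ → ℝ) (x : S2) :
    dPhi (modeTest ζ k p) x = k * ζ * modeTest ζ k p x := by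
  have h1 : HasDerivAt (fun s : ℝ => (cos s : ℂ) + ζ * (sin s : ℂ)) ζ 0 := by
    refine ((hasDerivAt_cos 0).ofReal_comp.add
      ((hasDerivAt_sin 0).ofReal_comp.const_mul ζ)).congr_deriv ?_
    simp
  have h2 := (h1.pow k).mul_const (modeTest ζ k p x)
  rw [dPhi, funext fun s => modeTest_rot hζ k p s x]
  refine h2.deriv.trans ?_
  simp

/-- The second derivative of a function on a line. -/
lemma iteratedFDeriv_two_apply_of_hasDerivAt {E F : Type*} [NormedAddCommGroup E]
    [NormedSpace ℝ E] [NormedAddCommGroup F] [NormedSpace ℝ F] {f : E → F} {x v : E}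
    (hf : ContDiffAt ℝ 2 f x) {g' : ℝ → F} {g'' : F}
    (h1 : ∀ᶠ t in 𝓝 (0 : ℝ), HasDerivAt (fun t : ℝ => f (x + t • v)) (g' t) t)
    (h2 : HasDerivAt g' g'' 0) :
    iteratedFDeriv ℝ 2 f x ![v, v] = g'' := by
  rw [iteratedFDeriv_two_apply]
  simp only [Matrix.cons_val_zero, Matrix.cons_val_one]
  have hl : ∀ t : ℝ, HasDerivAt (fun t : ℝ => x + t • v) v t := fun t => by
    simpa using ((hasDerivAt_id t).smul_const v).const_add x
  have hlc : Tendsto (fun t : ℝ => x + t • v) (𝓝 0) (𝓝 x) := by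
    have := (hl 0).continuousAt.tendsto
    simpa using this
  have hdiff : ∀ᶠ y in 𝓝 x, DifferentiableAt ℝ f y :=
    (hf.eventually (by simp)).mono fun y hy => hy.differentiableAt (by norm_num)
  have e1 : (fun t => fderiv ℝ f (x + t • v) v) =ᶠ[𝓝 0] g' := by
    filter_upwards [h1, hlc.eventually hdiff] with t ht ht'
    exact (ht'.hasFDerivAt.comp_hasDerivAt t (hl t)).unique ht
  have hd2 : DifferentiableAt ℝ (fderiv ℝ f) x :=
    (hf.fderiv_right (m := 1) (by norm_num)).differentiableAt (by norm_num)
  have h3 : HasDerivAt (fun t : ℝ => fderiv ℝ f (x + t • v)) (fderiv ℝ (fderiv ℝ f) x v) 0 :=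
    hd2.hasFDerivAt.comp_hasDerivAt_of_eq 0 (hl 0) (by simp)
  have h4 : HasDerivAt (fun t : ℝ => fderiv ℝ f (x + t • v) v) (fderiv ℝ (fderiv ℝ f) x v v) 0 := by
    simpa using h3.clm_apply (hasDerivAt_const 0 v)
  exact (h4.congr_of_eventuallyEq e1.symm).unique h2

lemma laplacian_eq_sum_of_hasDerivAt {f : E3 → ℂ} {x : E3} (hf : ContDiffAt ℝ 2 f x)
    {g' : Fin 3 → ℝ → ℂ} {g'' : Fin 3 → ℂ}
    (h1 : ∀ i, ∀ᶠ t in 𝓝 (0 : ℝ),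
      HasDerivAt (fun t : ℝ => f (x + t • EuclideanSpace.single i (1 : ℝ))) (g' i t) t)
    (h2 : ∀ i, HasDerivAt (g' i) (g'' i) 0) :
    Laplacian.laplacian f x = ∑ i, g'' i := by
  rw [InnerProductSpace.laplacian_eq_iteratedFDeriv_orthonormalBasis f
    (EuclideanSpace.basisFun (Fin 3) ℝ)]
  refine Finset.sum_congr rfl fun i _ => ?_
  rw [EuclideanSpace.basisFun_apply]
  exact iteratedFDeriv_two_apply_of_hasDerivAt hf (h1 i) (h2 i)

lemma radialExtension_modeTest (ζ : ℂ) (k : ℕ) (p : ℝ → ℝ) {y : E3} (hy : y ≠ 0) :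
    radialExtension (modeTest ζ k p) y
      = ((‖y‖⁻¹ : ℝ) * ((y 0 : ℂ) + ζ * (y 1 : ℂ))) ^ k * (p (‖y‖⁻¹ * y 2) : ℂ) := by
  rw [radialExtension, dif_neg hy, modeTest]
  simp only [PiLp.smul_apply, smul_eq_mul]
  push_cast
  ring

lemma contDiffAt_radialExtension_modeTest (ζ : ℂ) (k : ℕ) {p : ℝ → ℝ} (hp : ContDiff ℝ ∞ p)
    {y : E3} (hy : y ≠ 0) : ContDiffAt ℝ ∞ (radialExtension (modeTest ζ k p)) y := by
  have hr : ContDiffAt ℝ ∞ (fun y : E3 => ‖y‖⁻¹) y :=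
    (contDiffAt_norm ℝ hy).inv (norm_ne_zero_iff.2 hy)
  have hc : ∀ i, ContDiff ℝ ∞ fun y : E3 => y i := fun i => by fun_prop
  have ho : ContDiff ℝ ∞ (fun r : ℝ => (r : ℂ)) := Complex.ofRealCLM.contDiff
  have h := ((ho.contDiffAt.comp y hr).mul ((ho.comp (hc 0)).add
    (contDiff_const (c := ζ).mul (ho.comp (hc 1)))).contDiffAt).pow k
  refine (h.mul (ho.contDiffAt.comp y (hp.contDiffAt.comp y
    (hr.mul (hc 2).contDiffAt)))).congr_of_eventuallyEq ?_
  filter_upwards [isOpen_ne.mem_nhds hy] with z hz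
  exact radialExtension_modeTest ζ k p hz

lemma hasDerivAt_inv_sqrt_quadratic {a t : ℝ} (h : 0 < 1 + 2 * a * t + t ^ 2) :
    HasDerivAt (fun t : ℝ => (√(1 + 2 * a * t + t ^ 2))⁻¹)
      (-(a + t) * (√(1 + 2 * a * t + t ^ 2))⁻¹ ^ 3) t := by
  have h0 : HasDerivAt (fun t : ℝ => 1 + 2 * a * t + t ^ 2) (2 * a + 2 * t) t := by
    refine ((((hasDerivAt_id t).const_mul (2 * a)).const_add 1).add
      (hasDerivAt_pow 2 t)).congr_deriv ?_
    simp
  have hs : √(1 + 2 * a * t + t ^ 2) ≠ 0 := (Real.sqrt_pos.2 h).ne'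
  refine ((h0.sqrt h.ne').inv hs).congr_deriv ?_
  field_simp

section Line

variable {F : Type*} [NormedAddCommGroup F] [NormedSpace ℝ F]

lemma hasDerivAt_normalised {a t : ℝ} (h : 0 < 1 + 2 * a * t + t ^ 2) (c ε : F) :
    HasDerivAt (fun t : ℝ => (√(1 + 2 * a * t + t ^ 2))⁻¹ • (c + t • ε))
      ((√(1 + 2 * a * t + t ^ 2))⁻¹ • ε
        - ((a + t) * (√(1 + 2 * a * t + t ^ 2))⁻¹ ^ 3) • (c + t • ε)) t := by
  have h1 : HasDerivAt (fun t : ℝ => c + t • ε) ε t := by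
    simpa using ((hasDerivAt_id t).smul_const ε).const_add c
  refine ((hasDerivAt_inv_sqrt_quadratic h).smul h1).congr_deriv ?_
  module

lemma hasDerivAt_normalised_deriv (a : ℝ) (c ε : F) :
    HasDerivAt (fun t : ℝ => (√(1 + 2 * a * t + t ^ 2))⁻¹ • ε
        - ((a + t) * (√(1 + 2 * a * t + t ^ 2))⁻¹ ^ 3) • (c + t • ε))
      ((3 * a ^ 2 - 1) • c - (2 * a) • ε) 0 := by
  have h1 : HasDerivAt (fun t : ℝ => c + t • ε) ε 0 := by
    simpa using ((hasDerivAt_id (0 : ℝ)).smul_const ε).const_add c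
  have h2 : HasDerivAt (fun t : ℝ => a + t) 1 0 := by
    simpa using (hasDerivAt_id (0 : ℝ)).const_add a
  have h3 := hasDerivAt_inv_sqrt_quadratic (a := a) (t := 0) (by norm_num)
  refine ((h3.smul_const ε).sub ((h2.mul (h3.pow 3)).smul h1)).congr_deriv ?_
  simp
  module

end Line

/-- The second derivative along a line of a function `A^(n+1) p(τ)` of the normalised
coordinates. -/
lemma hasDerivAt_mode_line (n : ℕ) {p : ℝ → ℝ} (hp : ContDiff ℝ ∞ p) (a b δ : ℝ) (c ε : ℂ) :
    ∃ g' : ℝ → ℂ, (∀ᶠ t in 𝓝 (0 : ℝ), HasDerivAt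
      (fun t : ℝ => ((√(1 + 2 * a * t + t ^ 2))⁻¹ • (c + t • ε)) ^ (n + 1)
        * (p ((√(1 + 2 * a * t + t ^ 2))⁻¹ • (b + t • δ)) : ℂ)) (g' t) t) ∧
      HasDerivAt g' ((n + 1) * (n * c ^ (n - 1) * (ε - a * c) ^ 2
          + c ^ n * ((3 * a ^ 2 - 1) * c - 2 * a * ε)) * p b
        + 2 * (n + 1) * c ^ n * (ε - a * c) * (δ - a * b) * deriv p b
        + c ^ (n + 1) * (deriv (deriv p) b * (δ - a * b) ^ 2
          + deriv p b * ((3 * a ^ 2 - 1) * b - 2 * a * δ))) 0 := by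
  have hp1 : ContDiff ℝ ∞ (deriv p) := (contDiff_infty_iff_deriv.1 hp).2
  have hd : ∀ z, HasDerivAt p (deriv p z) z := fun z =>
    (hp.differentiable (by simp) z).hasDerivAt
  have hd1 : ∀ z, HasDerivAt (deriv p) (deriv (deriv p) z) z := fun z =>
    (hp1.differentiable (by simp) z).hasDerivAt
  set A : ℝ → ℂ := fun t => (√(1 + 2 * a * t + t ^ 2))⁻¹ • (c + t • ε) with hA
  set A1 : ℝ → ℂ := fun t => (√(1 + 2 * a * t + t ^ 2))⁻¹ • ε
        - ((a + t) * (√(1 + 2 * a * t + t ^ 2))⁻¹ ^ 3) • (c + t • ε) with hA1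
  set T : ℝ → ℝ := fun t => (√(1 + 2 * a * t + t ^ 2))⁻¹ • (b + t • δ) with hT
  set T1 : ℝ → ℝ := fun t => (√(1 + 2 * a * t + t ^ 2))⁻¹ • δ
        - ((a + t) * (√(1 + 2 * a * t + t ^ 2))⁻¹ ^ 3) • (b + t • δ) with hT1
  have hpos : ∀ᶠ t in 𝓝 (0 : ℝ), 0 < 1 + 2 * a * t + t ^ 2 := by
    have : ContinuousAt (fun t : ℝ => 1 + 2 * a * t + t ^ 2) 0 := by fun_prop
    exact this.eventually (lt_mem_nhds (by norm_num))
  have h0 : 0 < 1 + 2 * a * 0 + (0 : ℝ) ^ 2 := by norm_num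
  have dA := hasDerivAt_normalised h0 c ε
  have dT := hasDerivAt_normalised h0 b δ
  have dA1 := hasDerivAt_normalised_deriv a c ε
  have dT1 := hasDerivAt_normalised_deriv a b δ
  have eA : A 0 = c := by simp [hA]
  have eT : T 0 = b := by simp [hT]
  have eA1 : A1 0 = ε - a * c := by simp [hA1]
  have eT1 : T1 0 = δ - a * b := by simp [hT1]
  refine ⟨fun t => ((n + 1 : ℕ) * A t ^ n * A1 t) * (p (T t) : ℂ)
    + A t ^ (n + 1) * ((deriv p (T t) * T1 t : ℝ) : ℂ), ?_, ?_⟩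
  · filter_upwards [hpos] with t ht
    have d1 := (hasDerivAt_normalised ht c ε).pow (n + 1)
    have d2 := ((hd (T t)).comp t (hasDerivAt_normalised ht b δ)).ofReal_comp
    exact d1.mul d2
  · have d1 : HasDerivAt (fun t => (p (T t) : ℂ)) ((deriv p (T 0) * T1 0 : ℝ) : ℂ) 0 :=
      ((hd (T 0)).comp 0 dT).ofReal_comp
    have d2 : HasDerivAt (fun t => ((deriv p (T t) * T1 t : ℝ) : ℂ))
        ((deriv (deriv p) (T 0) * T1 0 * T1 0 + deriv p (T 0) * ((3 * a ^ 2 - 1) • b - (2 * a) • δ) : ℝ) : ℂ)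
        0 := (((hd1 (T 0)).comp 0 dT).mul dT1).ofReal_comp
    refine (((((dA.pow n).const_mul ((n + 1 : ℕ) : ℂ)).mul dA1).mul d1).add
      ((dA.pow (n + 1)).mul d2)).congr_deriv ?_
    change ((n + 1 : ℕ) * (n * A 0 ^ (n - 1) * A1 0) * A1 0 + (n + 1 : ℕ) * A 0 ^ n * _) * (p (T 0) : ℂ)
      + (n + 1 : ℕ) * A 0 ^ n * A1 0 * _ + ((n + 1 : ℕ) * A 0 ^ n * A1 0 * _ + A 0 ^ (n + 1) * _) = _
    rw [eA, eA1, eT, eT1]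
    simp only [smul_eq_mul, Complex.real_smul]
    push_cast
    ring

lemma norm_add_single {x : E3} (hx : ‖x‖ = 1) (i : Fin 3) (t : ℝ) :
    ‖x + t • EuclideanSpace.single i (1 : ℝ)‖ = √(1 + 2 * x i * t + t ^ 2) := by
  rw [eq_comm, Real.sqrt_eq_iff_eq_sq _ (norm_nonneg _), norm_add_sq_real, hx, norm_smul,
    inner_smul_right, EuclideanSpace.inner_single_right]
  · simp
    ring
  · have h := sq_nonneg (t + x i)
    have h1 : x i ^ 2 ≤ 1 := by
      have h2 := PiLp.norm_apply_le x i
      rw [hx, Real.norm_eq_abs] at h2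
      exact (sq_le_one_iff_abs_le_one _).2 h2
    nlinarith

/-- The Laplace–Beltrami operator on the test functions of the mode `n + 1`. -/
lemma laplaceBeltrami_modeTest {ζ : ℂ} (hζ : ζ ^ 2 = -1) (n : ℕ) {p : ℝ → ℝ}
    (hp : ContDiff ℝ ∞ p) (x : S2) :
    laplaceBeltrami (modeTest ζ (n + 1) p) x
      = modeTest ζ (n + 1) (fun z => (1 - z ^ 2) * deriv (deriv p) z - 2 * (n + 2) * z * deriv p z
          - (n + 1) * (n + 2) * p z) x := by
  have hx : ‖(x : E3)‖ = 1 := by simp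
  have hx0 : (x : E3) ≠ 0 := fun h => by simp [h] at hx
  have hs : ((x : E3) 0 : ℂ) ^ 2 + ((x : E3) 1 : ℂ) ^ 2 + ((x : E3) 2 : ℂ) ^ 2 = 1 := by
    have h := EuclideanSpace.norm_sq_eq (x : E3)
    rw [hx, Fin.sum_univ_three] at h
    simp only [Real.norm_eq_abs, sq_abs, one_pow] at h
    exact_mod_cast h.symm
  set c : ℂ := ((x : E3) 0 : ℂ) + ζ * ((x : E3) 1 : ℂ) with hc
  set b : ℝ := (x : E3) 2 with hb
  set ε : Fin 3 → ℂ := ![1, ζ, 0] with hε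
  set δ : Fin 3 → ℝ := ![0, 0, 1] with hδ
  choose g' h1 h2 using fun i => hasDerivAt_mode_line n hp ((x : E3) i) b (δ i) c (ε i)
  have h1' : ∀ i, ∀ᶠ t in 𝓝 (0 : ℝ), HasDerivAt (fun t : ℝ =>
      radialExtension (modeTest ζ (n + 1) p)
        ((x : E3) + t • EuclideanSpace.single i (1 : ℝ))) (g' i t) t := by
    intro i
    have hne : ∀ᶠ t in 𝓝 (0 : ℝ), (x : E3) + t • EuclideanSpace.single i (1 : ℝ) ≠ 0 := by
      have hcont : ContinuousAt
          (fun t : ℝ => (x : E3) + t • EuclideanSpace.single i (1 : ℝ)) 0 := by fun_prop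
      exact hcont.eventually_ne (by simpa using hx0)
    filter_upwards [h1 i, hne.eventually_nhds] with t ht ht'
    refine ht.congr_of_eventuallyEq ?_
    filter_upwards [ht'] with s hs'
    rw [radialExtension_modeTest ζ (n + 1) p hs', norm_add_single hx]
    simp only [Complex.real_smul, smul_eq_mul]
    congr 3
    · fin_cases i <;> simp [hc, hε] <;> ring
    · fin_cases i <;> simp [hb, hδ]
  rw [laplaceBeltrami, laplacian_eq_sum_of_hasDerivAt
    ((contDiffAt_radialExtension_modeTest ζ (n + 1) hp hx0).of_le (WithTop.coe_le_coe.2 (le_top : (2 : ℕ∞) ≤ ⊤))) h1' h2]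
  simp only [Fin.sum_univ_three, modeTest, hε, hδ, Matrix.cons_val]
  -- The truncated exponent n - 1 is harmless, as the factor n vanishes when n = 0.
  have hn : (n : ℂ) * c ^ (n - 1) * c ^ 2 = n * c ^ (n + 1) := by
    cases n with
    | zero => simp
    | succ k => rw [Nat.add_sub_cancel]; ring
  rw [← hc, ← hb]
  set x0 : ℂ := ((x : E3) 0 : ℂ)
  set x1 : ℂ := ((x : E3) 1 : ℂ)
  set x2 : ℂ := (b : ℂ) with hx2
  -- With A = (y₁ + ζ y₂)/|y| and T = y₃/|y|, the five identities give, at |y| = 1, the values ∇A·∇A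
  -- = -c², ΔA = -2c, ∇A·∇T = -bc, ∇T·∇T = 1 - b² and ΔT = -2b. The dot is bilinear, and ζ² = -1
  -- enters only the first.
  have e1 : (1 - x0 * c) ^ 2 + (ζ - x1 * c) ^ 2 + (0 - x2 * c) ^ 2 = -c ^ 2 := by
    linear_combination c ^ 2 * hs + hζ + 2 * c * hc
  have e2 : ((3 * x0 ^ 2 - 1) * c - 2 * x0 * 1) + ((3 * x1 ^ 2 - 1) * c - 2 * x1 * ζ)
      + ((3 * x2 ^ 2 - 1) * c - 2 * x2 * 0) = -2 * c := by
    linear_combination 3 * c * hs + 2 * hc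
  have e3 : (1 - x0 * c) * (0 - x0 * x2) + (ζ - x1 * c) * (0 - x1 * x2)
      + (0 - x2 * c) * (1 - x2 * x2) = -x2 * c := by
    linear_combination x2 * c * hs + x2 * hc
  have e4 : (0 - x0 * x2) ^ 2 + (0 - x1 * x2) ^ 2 + (1 - x2 * x2) ^ 2 = 1 - x2 ^ 2 := by
    linear_combination x2 ^ 2 * hs
  have e5 : ((3 * x0 ^ 2 - 1) * x2 - 2 * x0 * 0) + ((3 * x1 ^ 2 - 1) * x2 - 2 * x1 * 0)
      + ((3 * x2 ^ 2 - 1) * x2 - 2 * x2 * 1) = -2 * x2 := by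
    linear_combination 3 * x2 * hs
  push_cast
  rw [← hx2]
  clear_value c x0 x1 x2
  linear_combination (n + 1) * n * c ^ (n - 1) * (p b : ℂ) * e1 + (n + 1) * c ^ n * (p b : ℂ) * e2
    + 2 * (n + 1) * c ^ n * ((deriv p b : ℝ) : ℂ) * e3 + c ^ (n + 1) * ((deriv (deriv p) b : ℝ) : ℂ) * e4
    + c ^ (n + 1) * ((deriv p b : ℝ) : ℂ) * e5 - (n + 1) * (p b : ℂ) * hn


/-! ### Fourier coefficients in the longitude -/

lemma measurePreserving_spherePoint :
    MeasurePreserving spherePoint (((volume : Measure ℝ).restrict (Ioo (-1) 1)).prod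
      ((volume : Measure ℝ).restrict (Ioo (-π) π))) sigma := by
  refine ⟨continuous_spherePoint.measurable, ?_⟩
  rw [Measure.prod_restrict, ← Measure.volume_eq_prod, sigma_eq_map]

lemma integral_sigma {f : S2 → ℂ} (hf : Integrable f sigma) :
    ∫ x, f x ∂sigma
      = ∫ z in Ioo (-1 : ℝ) 1, ∫ φ in Ioo (-π) π, f (spherePoint (z, φ)) := by
  have hmp := measurePreserving_spherePoint
  have h1 := integral_map (f := f) hmp.measurable.aemeasurable
    (by rw [hmp.map_eq]; exact hf.aestronglyMeasurable)
  rw [hmp.map_eq] at h1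
  exact h1.trans (integral_prod _ (hmp.integrable_comp_of_integrable hf))

/-- The Fourier coefficient of order `k` in the longitude, as a function of the height. -/
def longitudeCoeff (k : ℤ) (f : S2 → ℂ) (z : ℝ) : ℂ :=
  (1 / (2 * π) : ℂ) *
    ∫ φ in Ioo (-π) π, f (spherePoint (z, φ)) * Complex.exp (-(Complex.I * k * φ))

lemma norm_exp_neg_I_mul (k : ℤ) (φ : ℝ) : ‖Complex.exp (-(Complex.I * k * φ))‖ = 1 := by
  rw [show -(Complex.I * (k : ℂ) * (φ : ℂ)) = ((-(k * φ) : ℝ) : ℂ) * Complex.I by push_cast; ring]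
  exact Complex.norm_exp_ofReal_mul_I _

lemma memLp_comp_mul_exp (k : ℤ) {f : S2 → ℂ} (hf : MemLp f 2 sigma) :
    MemLp (fun q : ℝ × ℝ => f (spherePoint q) * Complex.exp (-(Complex.I * k * q.2))) 2
      (((volume : Measure ℝ).restrict (Ioo (-1) 1)).prod
      ((volume : Measure ℝ).restrict (Ioo (-π) π))) := by
  have h1 := hf.comp_measurePreserving measurePreserving_spherePoint
  have hc : Continuous fun q : ℝ × ℝ => Complex.exp (-(Complex.I * k * q.2)) := by fun_prop
  refine h1.congr_norm (h1.aestronglyMeasurable.mul hc.aestronglyMeasurable) ?_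
  refine Eventually.of_forall fun q => ?_
  simp [norm_exp_neg_I_mul]

/-- Cauchy's inequality in φ on each circle of latitude, then Fubini in z. -/
lemma memLp_longitudeCoeff (k : ℤ) {f : S2 → ℂ} (hf : MemLp f 2 sigma) :
    MemLp (longitudeCoeff k f) 2 (volume.restrict (Ioo (-1) 1)) := by
  have h := memLp_comp_mul_exp k hf
  have hm : AEStronglyMeasurable (longitudeCoeff k f) (volume.restrict (Ioo (-1) 1)) :=
    (h.aestronglyMeasurable.integral_prod_right').const_mul _
  rw [memLp_two_iff_integrable_sq_norm hm]
  have hsq : Integrable (fun q : ℝ × ℝ =>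
      ‖f (spherePoint q) * Complex.exp (-(Complex.I * k * q.2))‖ ^ 2)
      (((volume : Measure ℝ).restrict (Ioo (-1) 1)).prod
      ((volume : Measure ℝ).restrict (Ioo (-π) π))) := h.integrable_norm_pow (by norm_num)
  have hi := hsq.integral_prod_left.const_mul ((1 / (2 * π)) ^ 2 *
    ((volume : Measure ℝ).restrict (Ioo (-π) π)).real univ)
  refine hi.mono' (hm.norm.pow 2) ?_
  filter_upwards [hsq.prod_right_ae, h.aestronglyMeasurable.prodMk_left] with z hz hz'
  have h2 := norm_integral_sq_le ((memLp_two_iff_integrable_sq_norm hz').2 hz)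
  rw [Real.norm_of_nonneg (sq_nonneg _), longitudeCoeff, norm_mul, mul_pow]
  have e : ‖(1 / (2 * π) : ℂ)‖ = 1 / (2 * π) := by
    rw [norm_div, norm_mul, Complex.norm_real, Real.norm_of_nonneg pi_pos.le]
    simp
  rw [e, mul_assoc]
  exact mul_le_mul_of_nonneg_left h2 (sq_nonneg _)

/-- The unit `∓ i`, for which `(x₁ ∓ i x₂)^|k|` is a multiple of `e^{-ikφ}`. -/
def modeUnit (k : ℤ) : ℂ := if k < 0 then Complex.I else -Complex.I

lemma modeUnit_sq (k : ℤ) : modeUnit k ^ 2 = -1 := by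
  rw [modeUnit]
  split_ifs <;> simp

lemma natAbs_mul_modeUnit (k : ℤ) : (k.natAbs : ℂ) * modeUnit k = -(Complex.I * k) := by
  rw [modeUnit, Nat.cast_natAbs]
  split_ifs with h
  · rw [abs_of_neg h]
    push_cast
    ring
  · rw [abs_of_nonneg (not_lt.1 h)]
    ring

lemma cos_add_modeUnit_mul_sin_pow (k : ℤ) (φ : ℝ) :
    ((cos φ : ℂ) + modeUnit k * (sin φ : ℂ)) ^ k.natAbs
      = Complex.exp (-(Complex.I * k * φ)) := by
  have h : (cos φ : ℂ) + modeUnit k * (sin φ : ℂ) = Complex.exp (φ * modeUnit k) := by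
    rw [modeUnit]
    split_ifs
    · rw [Complex.exp_mul_I]
      push_cast
      ring
    · rw [mul_neg, ← neg_mul, Complex.exp_mul_I, Complex.cos_neg, Complex.sin_neg]
      push_cast
      ring
  rw [h, ← Complex.exp_nat_mul]
  congr 1
  linear_combination (φ : ℂ) * natAbs_mul_modeUnit k

lemma modeTest_spherePoint (k : ℤ) (p : ℝ → ℝ) {z : ℝ} (hz : z ∈ Ioo (-1 : ℝ) 1) (φ : ℝ) :
    modeTest (modeUnit k) k.natAbs p (spherePoint (z, φ))
      = Complex.exp (-(Complex.I * k * φ)) * ((√(1 - z ^ 2) ^ k.natAbs * p z : ℝ) : ℂ) := by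
  rw [← cos_add_modeUnit_mul_sin_pow]
  simp only [modeTest, spherePoint, Matrix.cons_val, sin_arccos, cos_arccos hz.1.le hz.2.le]
  push_cast
  simp only [← mul_assoc, ← mul_pow]
  congr 2
  ring

lemma continuous_modeTest (ζ : ℂ) (k : ℕ) {p : ℝ → ℝ} (hp : Continuous p) :
    Continuous (modeTest ζ k p) := by
  have hc : ∀ i, Continuous fun x : S2 => (x : E3) i := fun i => by fun_prop
  have h0 := hc 0
  have h1 := hc 1
  have h2 := hc 2
  unfold modeTest
  fun_prop

lemma integral_mul_modeTest (k : ℤ) {f : S2 → ℂ} (hf : Integrable f sigma) {p : ℝ → ℝ}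
    (hp : Continuous p) :
    ∫ x, f x * modeTest (modeUnit k) k.natAbs p x ∂sigma
      = (2 * π) * ∫ z in Ioo (-1 : ℝ) 1,
          longitudeCoeff k f z * ((√(1 - z ^ 2) ^ k.natAbs * p z : ℝ) : ℂ) := by
  have hT := continuous_modeTest (modeUnit k) k.natAbs hp
  obtain ⟨C, hC⟩ := isCompact_univ.exists_bound_of_continuousOn hT.continuousOn
  rw [integral_sigma (hf.mul_bdd hT.aestronglyMeasurable
    (Eventually.of_forall fun x => hC x (mem_univ x))), ← integral_const_mul]
  refine setIntegral_congr_fun measurableSet_Ioo fun z hz => ?_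
  simp only [modeTest_spherePoint k p hz, ← mul_assoc]
  rw [integral_mul_const, longitudeCoeff]
  have : (π : ℂ) ≠ 0 := Complex.ofReal_ne_zero.2 pi_ne_zero
  field_simp

/-- The test function (x₁ ∓ i x₂)^|k| p(x₃) is w^(|k|/2) p(z) e^(-ikφ), so it sees only the k-th
coefficient. It is smooth on the whole sphere for every smooth p, without any condition on p at the
poles. -/
lemma weakMode_longitudeCoeff {u v : S2 → ℂ} (hu : MemLp u 2 sigma) (hv : MemLp v 2 sigma)
    (h : HasWeakLaplacian v u) {k : ℤ} {n : ℕ} (hn : k.natAbs = n + 1) :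
    WeakMode n (longitudeCoeff k u) (longitudeCoeff k v) where
  memU := memLp_longitudeCoeff k hu
  memV := memLp_longitudeCoeff k hv
  weak p hp := by
    have h1 := h _ (isSmooth_modeTest (modeUnit k) (n + 1) hp)
    simp only [laplaceBeltrami_modeTest (modeUnit_sq k) n hp] at h1
    have hp1 : ContDiff ℝ ∞ (deriv p) := (contDiff_infty_iff_deriv.1 hp).2
    have hp2 : ContDiff ℝ ∞ (deriv (deriv p)) := (contDiff_infty_iff_deriv.1 hp1).2
    have c0 := hp.continuous
    have c1 := hp1.continuous
    have c2 := hp2.continuous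
    rw [← hn, integral_mul_modeTest k (hu.integrable (by norm_num)) c0,
      integral_mul_modeTest k (hv.integrable (by norm_num)) (by fun_prop), hn] at h1
    have : (2 * π : ℂ) ≠ 0 := mul_ne_zero two_ne_zero (Complex.ofReal_ne_zero.2 pi_ne_zero)
    exact mul_left_cancel₀ this h1

lemma longitudeCoeff_congr_ae {f g : S2 → ℂ} (h : ∀ᵐ x ∂sigma, f x = g x) (k : ℤ) :
    ∀ᵐ z ∂(volume : Measure ℝ).restrict (Ioo (-1) 1), longitudeCoeff k f z = longitudeCoeff k g z := by
  have h1 := measurePreserving_spherePoint.quasiMeasurePreserving.ae h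
  filter_upwards [Measure.ae_ae_of_ae_prod h1] with z hz
  rw [longitudeCoeff, longitudeCoeff]
  congr 1
  refine integral_congr_ae ?_
  filter_upwards [hz] with φ hφ
  rw [hφ]

lemma longitudeCoeff_cosTheta_mul {u v : S2 → ℂ} (hu : MemLp u 2 sigma) (hv : MemLp v 2 sigma)
    (k : ℤ) : ∀ᵐ z ∂(volume : Measure ℝ).restrict (Ioo (-1) 1),
      longitudeCoeff k (fun x => (cosTheta x : ℂ) * (u x + 6 * v x)) z
        = z * (longitudeCoeff k u z + 6 * longitudeCoeff k v z) := by
  have h1 := ((memLp_comp_mul_exp k hu).integrable (by norm_num)).prod_right_ae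
  have h2 := ((memLp_comp_mul_exp k hv).integrable (by norm_num)).prod_right_ae
  filter_upwards [h1, h2, ae_restrict_mem measurableSet_Ioo] with z i1 i2 hz
  have e : ∀ φ, (cosTheta (spherePoint (z, φ)) : ℂ) * (u (spherePoint (z, φ))
      + 6 * v (spherePoint (z, φ))) * Complex.exp (-(Complex.I * k * φ))
      = z * (u (spherePoint (z, φ)) * Complex.exp (-(Complex.I * k * φ))
        + 6 * (v (spherePoint (z, φ)) * Complex.exp (-(Complex.I * k * φ)))) := by
    intro φ
    simp only [cosTheta, spherePoint, Matrix.cons_val, cos_arccos hz.1.le hz.2.le]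
    ring
  simp only [longitudeCoeff, e]
  rw [integral_const_mul, integral_add i1 (i2.const_mul 6), integral_const_mul]
  ring

lemma longitudeCoeff_const_mul (k : ℤ) (c : ℂ) (f : S2 → ℂ) (z : ℝ) :
    longitudeCoeff k (fun x => c * f x) z = c * longitudeCoeff k f z := by
  simp only [longitudeCoeff, mul_assoc]
  rw [integral_const_mul]
  ring

/-- The weight w^(|k|/2) has no zero in the open interval, so the functions p(z) with support inside
it already detect the coefficient. -/
lemma longitudeCoeff_eq_zero_of_integral (k : ℤ) {f : S2 → ℂ} (hf : MemLp f 2 sigma)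
    (h : ∀ p : ℝ → ℝ, ContDiff ℝ ∞ p →
      ∫ x, f x * modeTest (modeUnit k) k.natAbs p x ∂sigma = 0) :
    ∀ᵐ z ∂(volume : Measure ℝ).restrict (Ioo (-1) 1), longitudeCoeff k f z = 0 := by
  have hm : MemLp (fun z : ℝ => longitudeCoeff k f z * ((√(1 - z ^ 2) ^ k.natAbs : ℝ) : ℂ)) 2
      (volume.restrict (Ioo (-1) 1)) := by
    have hc : Continuous fun z : ℝ => ((√(1 - z ^ 2) ^ k.natAbs : ℝ) : ℂ) := by fun_prop
    refine (memLp_longitudeCoeff k hf).of_le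
      ((memLp_longitudeCoeff k hf).aestronglyMeasurable.mul hc.aestronglyMeasurable) ?_
    refine Eventually.of_forall fun z => ?_
    rw [norm_mul, Complex.norm_real, norm_pow, Real.norm_of_nonneg (Real.sqrt_nonneg _)]
    refine mul_le_of_le_one_right (norm_nonneg _) (pow_le_one₀ (Real.sqrt_nonneg _) ?_)
    refine Real.sqrt_le_one.2 ?_
    nlinarith [sq_nonneg z]
  have hloc : LocallyIntegrableOn
      (fun z : ℝ => longitudeCoeff k f z * ((√(1 - z ^ 2) ^ k.natAbs : ℝ) : ℂ))
      (Ioo (-1) 1) :=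
    IntegrableOn.locallyIntegrableOn (hm.integrable (by norm_num))
  have h0 := isOpen_Ioo.ae_eq_zero_of_integral_contDiff_smul_eq_zero hloc fun p hp _ hsupp => by
    have h1 := h p hp
    rw [integral_mul_modeTest k (hf.integrable (by norm_num)) hp.continuous] at h1
    have h2 := (mul_eq_zero.1 h1).resolve_left
      (mul_ne_zero two_ne_zero (Complex.ofReal_ne_zero.2 pi_ne_zero))
    rw [← setIntegral_eq_integral_of_forall_compl_eq_zero (s := Ioo (-1) 1), ← h2]
    · refine integral_congr_ae (Eventually.of_forall fun z => ?_)
      simp only [Complex.real_smul]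
      push_cast
      ring
    · intro z hz
      rw [image_eq_zero_of_notMem_tsupport fun hz' => hz (hsupp hz'), zero_smul]
  rw [ae_restrict_iff' measurableSet_Ioo]
  filter_upwards [h0] with z hz hz1
  refine (mul_eq_zero.1 (hz hz1)).resolve_right (Complex.ofReal_ne_zero.2 (pow_ne_zero _ ?_))
  exact (Real.sqrt_pos.2 (one_sub_sq_pos hz1)).ne'


lemma ae_eq_zero_of_longitude (u : L2)
    (h : ∀ᵐ z ∂(volume : Measure ℝ).restrict (Ioo (-1) 1),
      ∀ᵐ φ ∂(volume : Measure ℝ).restrict (Ioo (-π) π), u (spherePoint (z, φ)) = 0) : u = 0 := by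
  have hu := (Lp.stronglyMeasurable u).measurable
  have hs : MeasurableSet {x : S2 | u x = 0} := hu (measurableSet_singleton 0)
  have hmp := measurePreserving_spherePoint
  have h1 := (Measure.ae_prod_mem_iff_ae_ae_mem (hmp.measurable hs)).2 h
  have h2 := (ae_map_iff hmp.measurable.aemeasurable hs).2 h1
  rw [hmp.map_eq] at h2
  exact (Lp.eq_zero_iff_ae_eq_zero).2 h2

/-- Parseval's identity. -/
lemma ae_eq_zero_of_fourier {f : ℝ → ℂ} (hf : MemLp f 2 (volume.restrict (Ioo (-π) π)))
    (h : ∀ k : ℤ, ∫ φ in Ioo (-π) π, f φ * Complex.exp (-(Complex.I * k * φ)) = 0) :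
    ∀ᵐ φ ∂(volume : Measure ℝ).restrict (Ioo (-π) π), f φ = 0 := by
  have hab : -π < π := by linarith [pi_pos]
  have hf' : MemLp f 2 (volume.restrict (Ioc (-π) π)) := by
    rwa [← restrict_Ioo_eq_restrict_Ioc]
  have hs := hasSum_sq_fourierCoeffOn hab hf'
  have hz : ∀ k : ℤ, fourierCoeffOn hab f k = 0 := by
    intro k
    rw [fourierCoeffOn_eq_integral, intervalIntegral.integral_of_le hab.le,
      integral_Ioc_eq_integral_Ioo, smul_eq_zero]
    refine Or.inr (Eq.trans (integral_congr_ae (Eventually.of_forall fun φ => ?_)) (h k))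
    have hpi : (π : ℂ) ≠ 0 := Complex.ofReal_ne_zero.2 pi_ne_zero
    simp only [fourier_coe_apply, smul_eq_mul]
    rw [mul_comm]
    congr 2
    push_cast
    field_simp
    ring
  simp only [hz, norm_zero, ne_eq, OfNat.ofNat_ne_zero, not_false_eq_true, zero_pow] at hs
  have h0 := hs.unique hasSum_zero
  have h1 : ∫ φ in Ioo (-π) π, ‖f φ‖ ^ 2 = 0 := by
    rw [intervalIntegral.integral_of_le hab.le, integral_Ioc_eq_integral_Ioo] at h0
    exact (smul_eq_zero.1 h0).resolve_left (inv_ne_zero (by linarith [pi_pos]))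
  have h2 := (integral_eq_zero_iff_of_nonneg (fun φ => sq_nonneg ‖f φ‖)
    (hf.integrable_norm_pow (by norm_num))).1 h1
  filter_upwards [h2] with φ hφ
  simpa using hφ

lemma eq_zero_of_longitudeCoeff (u : L2)
    (h : ∀ k : ℤ, ∀ᵐ z ∂(volume : Measure ℝ).restrict (Ioo (-1) 1), longitudeCoeff k u z = 0) :
    u = 0 := by
  refine ae_eq_zero_of_longitude u ?_
  have hL := (Lp.memLp u).comp_measurePreserving measurePreserving_spherePoint
  have hsq : Integrable (fun q : ℝ × ℝ => ‖u (spherePoint q)‖ ^ 2)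
      (((volume : Measure ℝ).restrict (Ioo (-1) 1)).prod
      ((volume : Measure ℝ).restrict (Ioo (-π) π))) := hL.integrable_norm_pow (by norm_num)
  filter_upwards [ae_all_iff.2 h, hsq.prod_right_ae, hL.aestronglyMeasurable.prodMk_left]
    with z h1 h2 h3
  refine ae_eq_zero_of_fourier ((memLp_two_iff_integrable_sq_norm h3).2 h2) fun k => ?_
  have hpi : (π : ℂ) ≠ 0 := Complex.ofReal_ne_zero.2 pi_ne_zero
  exact (mul_eq_zero.1 (h1 k)).resolve_left (by simp [hpi])

/-! ### Absence of nonzero eigenvalues -/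

/-- Testing ∂_φ(cos θ (u + 6v)) = iμu in mode k gives k z(U + 6V) = μU. For k = 0 this is μU = 0;
for k ≠ 0 it is the equation of a single mode with the parameter μ/k ≠ 0. -/
lemma not_isEigenvalue_Lambda {μ : ℂ} (hμ : μ ≠ 0) : ¬ IsEigenvalue Lambda μ := by
  rintro ⟨u, hu0, -, -, v, ⟨-, -, hlap⟩, hd⟩
  refine hu0 (eq_zero_of_longitudeCoeff u fun k => ?_)
  have hu := Lp.memLp u
  have hv := Lp.memLp v
  set w : S2 → ℂ := fun x => (cosTheta x : ℂ) * (u x + 6 * v x) with hw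
  have hwL : MemLp w 2 sigma := by
    have hc : Continuous fun x : S2 => (cosTheta x : ℂ) := by
      unfold cosTheta
      fun_prop
    have huv := hu.add (hv.const_mul 6)
    refine huv.of_le (hc.aestronglyMeasurable.mul huv.aestronglyMeasurable) ?_
    refine Eventually.of_forall fun x => ?_
    have h1 : |cosTheta x| ≤ 1 := by
      have h2 := PiLp.norm_apply_le (x : E3) 2
      simpa [cosTheta] using h2
    simp only [hw, norm_mul, Complex.norm_real, Real.norm_eq_abs, Pi.add_apply]
    exact mul_le_of_le_one_left (norm_nonneg _) h1
  have hdL : MemLp (fun x => k * w x + -μ * u x) 2 sigma :=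
    (hwL.const_mul (k : ℂ)).add (hu.const_mul (-μ))
  have hz := longitudeCoeff_eq_zero_of_integral k hdL fun p hp => by
    have h1 := hd _ (isSmooth_modeTest (modeUnit k) k.natAbs hp)
    simp only [dPhi_modeTest (modeUnit_sq k), natAbs_mul_modeUnit] at h1
    have hT := continuous_modeTest (modeUnit k) k.natAbs hp.continuous
    obtain ⟨C, hC⟩ := isCompact_univ.exists_bound_of_continuousOn hT.continuousOn
    have hint : ∀ {f : S2 → ℂ}, MemLp f 2 sigma → Integrable
        (fun x => f x * modeTest (modeUnit k) k.natAbs p x) sigma := fun hf =>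
      (hf.integrable (by norm_num)).mul_bdd hT.aestronglyMeasurable
        (Eventually.of_forall fun x => hC x (mem_univ x))
    have e1 : ∫ x, w x * (-(Complex.I * k) * modeTest (modeUnit k) k.natAbs p x) ∂sigma
        = -(Complex.I * k) * ∫ x, w x * modeTest (modeUnit k) k.natAbs p x ∂sigma := by
      rw [← integral_const_mul]
      exact integral_congr_ae (Eventually.of_forall fun x => by ring)
    have e2 : ∫ x, Complex.I * (μ • u) x * modeTest (modeUnit k) k.natAbs p x ∂sigma
        = Complex.I * μ * ∫ x, u x * modeTest (modeUnit k) k.natAbs p x ∂sigma := by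
      rw [← integral_const_mul]
      refine integral_congr_ae ?_
      filter_upwards [Lp.coeFn_smul μ u] with x hx
      rw [hx, Pi.smul_apply, smul_eq_mul]
      ring
    have h2 := e1.symm.trans (h1.trans (congrArg Neg.neg e2))
    have e3 : ∀ x, (k * w x + -μ * u x) * modeTest (modeUnit k) k.natAbs p x
        = k * (w x * modeTest (modeUnit k) k.natAbs p x)
          + -μ * (u x * modeTest (modeUnit k) k.natAbs p x) := fun x => by ring
    simp only [e3]
    rw [integral_add ((hint hwL).const_mul _) ((hint hu).const_mul _), integral_const_mul,
      integral_const_mul]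
    refine mul_left_cancel₀ Complex.I_ne_zero ?_
    linear_combination -h2
  have hadd : ∀ᵐ z ∂(volume : Measure ℝ).restrict (Ioo (-1) 1),
      longitudeCoeff k (fun x => k * w x + -μ * u x) z
        = k * longitudeCoeff k w z + -μ * longitudeCoeff k u z := by
    have h1 := ((memLp_comp_mul_exp k hwL).integrable (by norm_num)).prod_right_ae
    have h2 := ((memLp_comp_mul_exp k hu).integrable (by norm_num)).prod_right_ae
    filter_upwards [h1, h2] with z i1 i2
    simp only [longitudeCoeff, add_mul, mul_assoc]
    simp only [mul_assoc] at i1 i2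
    rw [integral_add (i1.const_mul _) (i2.const_mul _), integral_const_mul, integral_const_mul]
    ring
  by_cases hk : k = 0
  · subst hk
    filter_upwards [hz, hadd] with z h1 h2
    rw [h1, Int.cast_zero, zero_mul, zero_add] at h2
    exact (mul_eq_zero.1 h2.symm).resolve_left (neg_ne_zero.2 hμ)
  · have hk' : (k : ℂ) ≠ 0 := Int.cast_ne_zero.2 hk
    obtain ⟨n, hn⟩ := Nat.exists_eq_succ_of_ne_zero (Int.natAbs_ne_zero.2 hk)
    rw [ae_restrict_iff' measurableSet_Ioo]
    refine (weakMode_longitudeCoeff hu hv hlap hn).ae_eq_zero (div_ne_zero hμ hk') ?_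
    rw [← ae_restrict_iff' measurableSet_Ioo]
    filter_upwards [hz, hadd, longitudeCoeff_cosTheta_mul hu hv k] with z h1 h2 h3
    rw [← h3, div_mul_eq_mul_div, eq_div_iff hk']
    linear_combination h1 - h2

lemma rot_spherePoint (s z φ : ℝ) : rot s (spherePoint (z, φ)) = spherePoint (z, φ + s) := by
  refine Subtype.ext ?_
  simp only [rot, spherePoint, Matrix.cons_val, cos_add, sin_add]
  congr 1
  ext i
  fin_cases i <;> simp <;> ring

lemma modeProjection_spherePoint (m : ℤ) (f : S2 → ℂ) (z φ : ℝ) :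
    modeProjection m f (spherePoint (z, φ))
      = Complex.exp (Complex.I * m * φ) * longitudeCoeff m f z := by
  have hper : Function.Periodic (fun t : ℝ => f (spherePoint (z, t))
      * Complex.exp (-(Complex.I * m * t))) (2 * π) := by
    intro t
    have h1 : spherePoint (z, t + 2 * π) = spherePoint (z, t) := by
      simp only [spherePoint, cos_add_two_pi, sin_add_two_pi]
    have h2 : Complex.exp (-(Complex.I * m * ((t + 2 * π : ℝ) : ℂ)))
        = Complex.exp (-(Complex.I * m * t)) := by
      rw [Complex.exp_eq_exp_iff_exists_int]
      exact ⟨-m, by push_cast; ring⟩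
    simp only [h1, h2]
  have e1 : ∀ s : ℝ, f (rot s (spherePoint (z, φ))) * Complex.exp (-(Complex.I * m * s))
      = Complex.exp (Complex.I * m * φ) * (fun t : ℝ => f (spherePoint (z, t))
      * Complex.exp (-(Complex.I * m * t))) (s + φ) := by
    intro s
    simp only
    rw [rot_spherePoint, add_comm φ s, mul_left_comm, ← Complex.exp_add]
    congr 2
    push_cast
    ring
  rw [modeProjection]
  simp only [e1]
  rw [intervalIntegral.integral_const_mul, intervalIntegral.integral_comp_add_right
    (fun t : ℝ => f (spherePoint (z, t)) * Complex.exp (-(Complex.I * m * t))), zero_add,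
    add_comm (2 * π), hper.intervalIntegral_add_eq φ (-π),
    show -π + 2 * π = π by ring, intervalIntegral.integral_of_le (by linarith [pi_pos]),
    integral_Ioc_eq_integral_Ioo, longitudeCoeff]
  ring

lemma not_isEigenvalue_LambdaMode {m : ℤ} (hm : m ≠ 0) {μ : ℂ} (hμ : μ ≠ 0) :
    ¬ IsEigenvalue (LambdaMode m) μ := by
  rintro ⟨u, hu0, ⟨f, -, hf⟩, -, v, ⟨-, -, hlap⟩, heq⟩
  refine hu0 (ae_eq_zero_of_longitude u ?_)
  have hu := Lp.memLp u
  have hv := Lp.memLp v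
  obtain ⟨n, hn⟩ := Nat.exists_eq_succ_of_ne_zero (Int.natAbs_ne_zero.2 hm)
  have heq' : ∀ᵐ x ∂sigma, (cosTheta x : ℂ) * (u x + 6 * v x) = μ * u x := by
    filter_upwards [heq, Lp.coeFn_smul μ u] with x h1 h2
    rw [← h1]
    exact h2
  have hU : ∀ᵐ z ∂(volume : Measure ℝ).restrict (Ioo (-1) 1), longitudeCoeff m u z = 0 := by
    rw [ae_restrict_iff' measurableSet_Ioo]
    refine (weakMode_longitudeCoeff hu hv hlap hn).ae_eq_zero hμ ?_
    rw [← ae_restrict_iff' measurableSet_Ioo]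
    filter_upwards [longitudeCoeff_congr_ae heq' m, longitudeCoeff_cosTheta_mul hu hv m]
      with z h1 h2
    rw [← h2, h1, longitudeCoeff_const_mul]
  have h1 := Measure.ae_ae_of_ae_prod (measurePreserving_spherePoint.quasiMeasurePreserving.ae hf)
  filter_upwards [hU, h1] with z hz hz1
  -- As u is the m-th mode of f, it equals e^(imφ) times the coefficient of f, and the two
  -- coefficients agree; hence u is determined by its own m-th coefficient, already shown to vanish.
  have hC : longitudeCoeff m u z = longitudeCoeff m f z := by
    have hpi : (π : ℂ) ≠ 0 := Complex.ofReal_ne_zero.2 pi_ne_zero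
    have e1 : ∫ φ in Ioo (-π) π, u (spherePoint (z, φ)) * Complex.exp (-(Complex.I * m * φ))
        = ∫ φ in Ioo (-π) π, longitudeCoeff m f z := by
      refine integral_congr_ae ?_
      filter_upwards [hz1] with φ hφ
      rw [hφ, modeProjection_spherePoint, mul_right_comm, ← Complex.exp_add, add_neg_cancel,
        Complex.exp_zero, one_mul]
    rw [longitudeCoeff, e1, setIntegral_const, Real.volume_real_Ioo_of_le (by linarith [pi_pos]),
      Complex.real_smul]
    push_cast
    field_simp
    ring
  filter_upwards [hz1] with φ hφ
  rw [hφ, modeProjection_spherePoint, ← hC, hz, mul_zero]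

end SphereFlow

end

theorem theorem1p2 :
    (∀ μ : ℂ, μ ≠ 0 → ¬ SphereFlow.IsEigenvalue SphereFlow.Lambda μ) ∧
    (∀ m : ℤ, m ≠ 0 → ∀ μ : ℂ, μ ≠ 0 →
      ¬ SphereFlow.IsEigenvalue (SphereFlow.LambdaMode m) μ) :=
  ⟨fun _ hμ => SphereFlow.not_isEigenvalue_Lambda hμ,
    fun _ hm _ hμ => SphereFlow.not_isEigenvalue_LambdaMode hm hμ⟩
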